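/- Let $\mathbf T^2=\mathbf R^2/(2\pi\mathbf Z)^2$ and let $M,N$ be integers with $2\le M\le N$. Let $p(\xi)$ be a polynomial in $\xi=(\xi_1,\xi_2)$ with real coefficients and $q(\xi,\epsilon)$ a polynomial in $(\xi,\epsilon)$ with complex coefficients, such that $d_\xi p(0)$ and $\mathrm{Re}\,d_\xi q(0,0)$ are linearly independent. Let $\kappa>0$, and let $r(x,\xi,\epsilon)$ be, for each $\epsilon\in(0,\kappa)$, holomorphic in $(x,\xi)$ and $(2\pi\mathbf Z)^2$-periodic in $x$ in the complex domain $|\mathrm{Im}\,x_j|<\kappa$, $|\xi|<\kappa$, with $r=\mathcal O(\epsilon^M+|\xi|^N)$ uniformly there. Put $$p(x,\xi,\epsilon)=p(\xi)+i\epsilon q(\xi,\epsilon)+r(x,\xi,\epsilon).$$ Call a smooth function on $\mathbf R^2$ grad-periodic if its gradient is $(2\pi\mathbf Z)^2$-periodic. For $\xi$ and $\epsilon$ small, let $y_1,y_2$ be the (complex-valued) linear functions of $x\in\mathbf R^2$ with $l_j\cdot\partial_x y_k=\delta_{jk}$, where $l_1=p'_\xi(\xi)$, $l_2=q'_\xi(\xi,\epsilon)$,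 and put $w^*=\frac12\left(\epsilon y_1+\frac1i y_2\right)$. **Proposition 4.1.** For every $C_0>0$ there are $\epsilon_0>0$, $\delta>0$ and constants $C_s$ ($s>1$) such that for all $\epsilon,\widetilde\epsilon\in(0,\epsilon_0)$ with $$\frac{\epsilon^M+\widetilde\epsilon^N}{\epsilon\min(\epsilon,\widetilde\epsilon)}\le\delta$$ and all $\xi\in\mathbf R^2$ with $|\xi|\le C_0\widetilde\epsilon$, the following holds. The functions $y_1,y_2$ exist, and the Hamilton–Jacobi equation $$p(x,\varphi'_x(x),\epsilon)=p(\xi)+i\epsilon q(\xi,\epsilon),\qquad x\in\mathbf R^2,$$ has a solution $\varphi(x)=x\cdot\xi+\widetilde\epsilon\rho(x)$, with $|\varphi'_x(x)|<\kappa$ for all $x$, where $\rho$ is grad-periodic of the form $\rho=\rho_{\rm per}+b\,w^*$ with $\rho_{\rm per}$ smooth and $(2\pi\mathbf Z)^2$-periodic and $b\in\mathbf C$. Moreover $$\|\rho'_x\|_{H^s(\mathbf T^2)}\le C_s\,\frac{\epsilon^M+\widetilde\epsilon^N}{\epsilon\widetilde\epsilon}\qquad\text{for all } s>1.$$ -/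

import Mathlib

open Complex MeasureTheory
open scoped ENNReal ContDiff

namespace HamiltonJacobi

noncomputable section

/-- The normal form part `p(ζ) + i ε q(ζ, ε)` of the symbol. Here `p` is a polynomial in
`ζ = (ζ₁, ζ₂)` with real coefficients and `q` is a polynomial in `(ζ₁, ζ₂, ε)` with complex
coefficients; `ζ` may be complex. -/
def normalForm (p : MvPolynomial (Fin 2) ℝ) (q : MvPolynomial (Fin 3) ℂ)
    (ζ : Fin 2 → ℂ) (ε : ℝ) : ℂ :=
  MvPolynomial.aeval ζ p + I * (ε : ℂ) * MvPolynomial.eval ![ζ 0, ζ 1, (ε : ℂ)] q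

/-- The full symbol `p(x, ζ, ε) = p(ζ) + i ε q(ζ, ε) + r(x, ζ, ε)`. -/
def symbol (p : MvPolynomial (Fin 2) ℝ) (q : MvPolynomial (Fin 3) ℂ)
    (r : (Fin 2 → ℂ) → (Fin 2 → ℂ) → ℝ → ℂ) (x ζ : Fin 2 → ℂ) (ε : ℝ) : ℂ :=
  normalForm p q ζ ε + r x ζ ε

/-- The gradient `p'_ξ(ζ)`. -/
def gradP (p : MvPolynomial (Fin 2) ℝ) (ζ : Fin 2 → ℂ) : Fin 2 → ℂ :=
  fun i => MvPolynomial.aeval ζ (MvPolynomial.pderiv i p)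

/-- The gradient `q'_ξ(ζ, ε)`, with respect to the first two variables. -/
def gradQ (q : MvPolynomial (Fin 3) ℂ) (ζ : Fin 2 → ℂ) (ε : ℝ) : Fin 2 → ℂ :=
  fun i => MvPolynomial.eval ![ζ 0, ζ 1, (ε : ℂ)] (MvPolynomial.pderiv i.castSucc q)

/-- The complex neighbourhood `|Im x_j| < κ`, `|ζ| < κ` of the zero section of `T^*𝕋²`, lifted
to the universal cover in `x`. -/
def complexNhd (κ : ℝ) : Set ((Fin 2 → ℂ) × (Fin 2 → ℂ)) :=
  {z | (∀ i, |(z.1 i).im| < κ) ∧ ‖z.2‖ < κ}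

/-- `r` is a holomorphic function of `(x, ζ)` in a fixed complex neighbourhood of the zero section
of `T^*𝕋²`, and is `O(ε^M + |ζ|^N)` there. -/
structure IsRemainder (κ K : ℝ) (M N : ℕ)
    (r : (Fin 2 → ℂ) → (Fin 2 → ℂ) → ℝ → ℂ) : Prop where
  holomorphic : ∀ ε ∈ Set.Ioo 0 κ,
    DifferentiableOn ℂ (fun z : (Fin 2 → ℂ) × (Fin 2 → ℂ) => r z.1 z.2 ε) (complexNhd κ)
  periodic : ∀ ε ∈ Set.Ioo 0 κ, ∀ x ζ, (x, ζ) ∈ complexNhd κ → ∀ k : Fin 2 → ℤ,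
    r (fun i => x i + 2 * Real.pi * (k i : ℂ)) ζ ε = r x ζ ε
  bound : ∀ ε ∈ Set.Ioo 0 κ, ∀ x ζ, (x, ζ) ∈ complexNhd κ →
    ‖r x ζ ε‖ ≤ K * (ε ^ M + ‖ζ‖ ^ N)

/-- The gradient `u'_x` of a function on `ℝ²`. -/
def grad (u : (Fin 2 → ℝ) → ℂ) (x : Fin 2 → ℝ) : Fin 2 → ℂ :=
  fun i => fderiv ℝ u x (Pi.single i 1)

/-- Functions on `ℝ²` that are `(2πℤ)²`-periodic, that is, functions on `𝕋² = ℝ²/(2πℤ)²`. -/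
def TorusPeriodic {E : Type*} (u : (Fin 2 → ℝ) → E) : Prop :=
  ∀ (k : Fin 2 → ℤ) (x : Fin 2 → ℝ), u (fun i => x i + 2 * Real.pi * (k i : ℝ)) = u x

/-- A grad-periodic function: a smooth multi-valued function on `𝕋²` (given by its lift to `ℝ²`)
whose gradient is single-valued on `𝕋²`. -/
def GradPeriodic (u : (Fin 2 → ℝ) → ℂ) : Prop :=
  ContDiff ℝ ∞ u ∧ TorusPeriodic (grad u)

/-- The Fourier coefficient `(2π)⁻² ∫_{[0,2π]²} u(x) e^{-i k·x} dx`. -/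
def fourierCoeffTorus (u : (Fin 2 → ℝ) → ℂ) (k : Fin 2 → ℤ) : ℂ :=
  (1 / (2 * Real.pi) ^ 2 : ℂ) *
    ∫ x in Set.Icc (0 : Fin 2 → ℝ) (fun _ => 2 * Real.pi),
      u x * Complex.exp (-(I * ∑ i, (k i : ℂ) * (x i : ℂ)))

/-- The `H^s(𝕋²)`-norm of a periodic `ℂ²`-valued function, with value `∞` when the function does
not belong to `H^s`. -/
def sobolevNorm (s : ℝ) (v : (Fin 2 → ℝ) → Fin 2 → ℂ) : ℝ≥0∞ :=
  (∑' k : Fin 2 → ℤ, ENNReal.ofReal ((1 + ∑ i, (k i : ℝ) ^ 2) ^ s) *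
    ∑ j, ‖fourierCoeffTorus (fun x => v x j) k‖ₑ ^ 2) ^ (1 / 2 : ℝ)

/-- `y₁, y₂` are linear functions of `x ∈ ℝ²` with `l_j · ∂_x y_k = δ_{jk}`. -/
def IsDualPair (l : Fin 2 → Fin 2 → ℂ) (y : Fin 2 → ((Fin 2 → ℝ) →ₗ[ℝ] ℂ)) : Prop :=
  ∀ j k, ∑ i, l j i * y k (Pi.single i 1) = if j = k then 1 else 0

/-- `w^* = (ε y₁ + y₂ / i) / 2`. -/
def wStar (ε : ℝ) (y : Fin 2 → ((Fin 2 → ℝ) →ₗ[ℝ] ℂ)) (x : Fin 2 → ℝ) : ℂ :=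
  (1 / 2) * ((ε : ℂ) * y 0 x + (1 / I) * y 1 x)

/-- The phase `φ(x) = x·ξ + ε̃ ρ(x)`; `e` stands for `ε̃`. -/
def phase (ξ : Fin 2 → ℝ) (e : ℝ) (ρ : (Fin 2 → ℝ) → ℂ) (x : Fin 2 → ℝ) : ℂ :=
  ((∑ i, x i * ξ i : ℝ) : ℂ) + (e : ℂ) * ρ x

/-- `φ` solves `p(x, φ'_x(x), ε) = z` on `ℝ²`, where it is part of the claim that `(x, φ'_x(x))`
stays in the domain of the symbol. -/
def SolvesHJ (κ : ℝ) (P : (Fin 2 → ℂ) → (Fin 2 → ℂ) → ℝ → ℂ) (ε : ℝ) (z : ℂ)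
    (φ : (Fin 2 → ℝ) → ℂ) : Prop :=
  ∀ x : Fin 2 → ℝ, ((fun i => (x i : ℂ)), grad φ x) ∈ complexNhd κ ∧
    P (fun i => (x i : ℂ)) (grad φ x) ε = z

end

end HamiltonJacobi

/-! Write v = ρ'_x, e = ε̃, and expand the normal form at ξ. The equation becomes (l₁ + iε l₂)·v =
-e⁻¹(Q(ev) + Φ(v)), where Q is the Taylor remainder of order two of the normal form and Φ(v)(x) =
r(x, ξ + e v(x), ε). It is solved as a fixed point equation for the gradient v.

The linear part acts on e^{ik·x} with symbol i(l₁·k + iε l₂·k). Since l₁ is real, the real part of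
l₁·k + iε l₂·k is l₁·k up to O(ε|k|) and its imaginary part is ε Re l₂·k. Independence of l₁ and Re
l₂ then gives |k| ≤ (C/ε)|l₁·k + iε l₂·k| (`freqLength_le_norm_transportSymbol`). The mean value
cannot be reached by periodic functions; w^* supplies it, because the transport operator maps w^* to
the constant ε. Hence "solve, then take the gradient" is bounded by O(1/ε)
(`exists_transport_inverse`).

The function space is a Wiener algebra with exponential weights. It is a Banach algebra, so
polynomials act on it with a quadratic estimate (`exists_norm_aeval_sub_sub_le`), and r acts through
an iterated Cauchy integral over resolvents (`exists_composition`), with size and Lipschitz constant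
O(μ), μ = ε^M + e^N. Point evaluations are characters, which turn identities in the algebra into
pointwise ones. The exponential weight dominates every Sobolev weight
(`Wiener.exists_sobolevNorm_le`), so one contraction gives all s, with ε₀ and δ independent of s.

On a ball of radius R ~ μ/(εe) the map has Lipschitz constant of order eR/ε + μ/(εe) ~ μ/ε² +
μ/(εe), which is at most a constant times μ/(ε min(ε, e)). This is the smallness assumption, and R
is the asserted bound (`exists_gradient_solution`). -/

namespace HamiltonJacobi

noncomputable section

/-! ### Continuous linear maps out of `ℓ¹` -/

section L1

variable {J E : Type*} [NormedAddCommGroup E] [NormedSpace ℂ E]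

theorem summable_norm_l1 (f : lp (fun _ : J => ℂ) 1) : Summable fun j => ‖f j‖ := by
  simpa using (lp.memℓp f).summable (by simp)

theorem norm_l1_eq_tsum (f : lp (fun _ : J => ℂ) 1) : ‖f‖ = ∑' j, ‖f j‖ := by
  simpa using lp.norm_eq_tsum_rpow (by simp) f

theorem summable_norm_l1_smul (e : J → E) {C : ℝ} (he : ∀ j, ‖e j‖ ≤ C)
    (f : lp (fun _ : J => ℂ) 1) : Summable fun j => ‖f j • e j‖ := by
  refine Summable.of_nonneg_of_le (fun _ => norm_nonneg _) (fun j => ?_)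
    ((summable_norm_l1 f).mul_right C)
  rw [norm_smul]
  exact mul_le_mul_of_nonneg_left (he j) (norm_nonneg _)


/-- The continuous linear map `f ↦ ∑ j, f j • e j` attached to a bounded family `e`. -/
def l1Lift [CompleteSpace E] (e : J → E) (C : ℝ) (he : ∀ j, ‖e j‖ ≤ C) :
    lp (fun _ : J => ℂ) 1 →L[ℂ] E :=
  LinearMap.mkContinuous
    { toFun := fun f => ∑' j, f j • e j
      map_add' := fun f g => by
        rw [← Summable.tsum_add (summable_norm_l1_smul e he f).of_norm
          (summable_norm_l1_smul e he g).of_norm]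
        simp [add_smul]
      map_smul' := fun c f => by
        rw [RingHom.id_apply, ← (summable_norm_l1_smul e he f).of_norm.tsum_const_smul]
        simp [smul_smul] } C (fun f => by
      have h := summable_norm_l1_smul e he f
      refine (norm_tsum_le_tsum_norm h).trans ?_
      rw [norm_l1_eq_tsum, ← tsum_mul_left]
      refine h.tsum_le_tsum (fun j => ?_) ((summable_norm_l1 f).mul_left C)
      rw [norm_smul, mul_comm]
      exact mul_le_mul_of_nonneg_right (he j) (norm_nonneg _))

theorem l1Lift_apply [CompleteSpace E] (e : J → E) (C : ℝ) (he : ∀ j, ‖e j‖ ≤ C)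
    (f : lp (fun _ : J => ℂ) 1) :
    l1Lift e C he f = ∑' j, f j • e j := rfl

theorem hasSum_l1Lift [CompleteSpace E] (e : J → E) (C : ℝ) (he : ∀ j, ‖e j‖ ≤ C)
    (f : lp (fun _ : J => ℂ) 1) :
    HasSum (fun j => f j • e j) (l1Lift e C he f) :=
  (summable_norm_l1_smul e he f).of_norm.hasSum

theorem l1Lift_single [CompleteSpace E] [DecidableEq J] (e : J → E) (C : ℝ)
    (he : ∀ j, ‖e j‖ ≤ C) (j : J) (c : ℂ) :
    l1Lift e C he (lp.single 1 j c) = c • e j := by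
  rw [l1Lift_apply, tsum_eq_single j, lp.single_apply_self]
  intro i hi
  rw [lp.single_apply_ne _ _ _ hi, zero_smul]

theorem norm_l1Lift_le [CompleteSpace E] (e : J → E) (C : ℝ) (he : ∀ j, ‖e j‖ ≤ C) (hC : 0 ≤ C) :
    ‖l1Lift e C he‖ ≤ C :=
  LinearMap.mkContinuous_norm_le _ hC _

theorem l1_ext [DecidableEq J] {S T : lp (fun _ : J => ℂ) 1 →L[ℂ] E}
    (h : ∀ j, S (lp.single 1 j 1) = T (lp.single 1 j 1)) : S = T := by
  refine lp.ext_continuousLinearMap (by simp) fun j => ?_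
  ext
  simpa using h j

end L1

/-! ### The Wiener algebra with exponential weights -/

/-- The `ℓ¹`-length of a frequency. -/
def freqLength (k : Fin 2 → ℤ) : ℝ := ∑ i, |(k i : ℝ)|

theorem freqLength_nonneg (k : Fin 2 → ℤ) : 0 ≤ freqLength k :=
  Finset.sum_nonneg fun _ _ => abs_nonneg _

theorem freqLength_add_le (j k : Fin 2 → ℤ) :
    freqLength (j + k) ≤ freqLength j + freqLength k := by
  rw [freqLength, freqLength, freqLength, ← Finset.sum_add_distrib]
  refine Finset.sum_le_sum fun i _ => ?_
  simpa using abs_add_le (j i : ℝ) (k i)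

/-- The weight `e^{a|k|₁}`. -/
def weight (a : NNReal) (k : Fin 2 → ℤ) : ℝ := Real.exp (a * freqLength k)

theorem weight_pos (a : NNReal) (k : Fin 2 → ℤ) : 0 < weight a k := Real.exp_pos _

theorem weight_ne_zero (a : NNReal) (k : Fin 2 → ℤ) : (weight a k : ℂ) ≠ 0 :=
  ofReal_ne_zero.mpr (weight_pos a k).ne'

theorem one_le_weight (a : NNReal) (k : Fin 2 → ℤ) : 1 ≤ weight a k :=
  Real.one_le_exp (mul_nonneg a.2 (freqLength_nonneg k))

theorem weight_zero (a : NNReal) : weight a 0 = 1 := by simp [weight, freqLength]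

theorem weight_add_le (a : NNReal) (j k : Fin 2 → ℤ) :
    weight a (j + k) ≤ weight a j * weight a k := by
  rw [weight, weight, weight, ← Real.exp_add, ← mul_add]
  exact Real.exp_le_exp.mpr (mul_le_mul_of_nonneg_left (freqLength_add_le j k) a.2)

/-- The algebra of functions `∑ c_k e^{ik·x}` on `𝕋²` with `∑ |c_k| e^{a|k|₁} < ∞`. Its elements are
stored as the sequences `c_k e^{a|k|₁}`. -/
def Wiener (_ : NNReal) : Type := lp (fun _ : Fin 2 → ℤ => ℂ) 1

namespace Wiener

variable {a : NNReal}

instance : NormedAddCommGroup (Wiener a) :=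
  inferInstanceAs (NormedAddCommGroup (lp (fun _ : Fin 2 → ℤ => ℂ) 1))

instance : NormedSpace ℂ (Wiener a) :=
  inferInstanceAs (NormedSpace ℂ (lp (fun _ : Fin 2 → ℤ => ℂ) 1))

instance : CompleteSpace (Wiener a) :=
  inferInstanceAs (CompleteSpace (lp (fun _ : Fin 2 → ℤ => ℂ) 1))

/-- The normalized exponential `e^{ik·x} e^{-a|k|₁}`. -/
def unitMode (k : Fin 2 → ℤ) : Wiener a := lp.single (E := fun _ => ℂ) 1 k 1

theorem norm_unitMode (k : Fin 2 → ℤ) : ‖(unitMode k : Wiener a)‖ = 1 := by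
  exact (lp.norm_single (E := fun _ : Fin 2 → ℤ => ℂ) (p := 1) (by simp) k (1 : ℂ)).trans norm_one

/-- The continuous linear map with prescribed values on the normalized exponentials. -/
def lift {E : Type*} [NormedAddCommGroup E] [NormedSpace ℂ E] [CompleteSpace E]
    (e : (Fin 2 → ℤ) → E) (C : ℝ) (he : ∀ j, ‖e j‖ ≤ C) : Wiener a →L[ℂ] E :=
  l1Lift e C he

section lift

variable {E : Type*} [NormedAddCommGroup E] [NormedSpace ℂ E]

theorem lift_unitMode [CompleteSpace E] (e : (Fin 2 → ℤ) → E) (C : ℝ) (he : ∀ j, ‖e j‖ ≤ C)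
    (k : Fin 2 → ℤ) :
    lift e C he (unitMode k : Wiener a) = e k :=
  (l1Lift_single e C he k 1).trans (one_smul _ _)

theorem norm_lift_le [CompleteSpace E] (e : (Fin 2 → ℤ) → E) (C : ℝ) (he : ∀ j, ‖e j‖ ≤ C)
    (hC : 0 ≤ C) :
    ‖(lift e C he : Wiener a →L[ℂ] E)‖ ≤ C :=
  norm_l1Lift_le e C he hC

/-- The modes span a dense subspace of ℓ¹. Applied once per variable, this reduces the multilinear
identities below to computations with exponentials. -/
theorem hom_ext {S T : Wiener a →L[ℂ] E} (h : ∀ k, S (unitMode k) = T (unitMode k)) : S = T :=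
  l1_ext (J := Fin 2 → ℤ) h

end lift

/-- The structure constants `e^{a|j+k|₁} / (e^{a|j|₁} e^{a|k|₁})`. -/
def cocycle (a : NNReal) (j k : Fin 2 → ℤ) : ℂ :=
  (weight a (j + k) : ℂ) / (weight a j * weight a k)

theorem norm_cocycle_le (j k : Fin 2 → ℤ) : ‖cocycle a j k‖ ≤ 1 := by
  have hj := weight_pos a j
  have hk := weight_pos a k
  rw [cocycle, norm_div, norm_mul, norm_real, norm_real, norm_real, Real.norm_of_nonneg hj.le,
    Real.norm_of_nonneg hk.le, Real.norm_of_nonneg (weight_pos a _).le,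
    div_le_one (mul_pos hj hk)]
  exact weight_add_le a j k

theorem norm_cocycle_smul_unitMode_le (j k : Fin 2 → ℤ) :
    ‖cocycle a j k • (unitMode (j + k) : Wiener a)‖ ≤ 1 := by
  rw [norm_smul, norm_unitMode, mul_one]
  exact norm_cocycle_le j k

/-- Multiplication of functions as a continuous bilinear map. -/
def mulL (a : NNReal) : Wiener a →L[ℂ] Wiener a →L[ℂ] Wiener a :=
  lift (fun j => lift (fun k => cocycle a j k • unitMode (j + k)) 1
    (norm_cocycle_smul_unitMode_le j)) 1 (fun _ => norm_lift_le _ _ _ zero_le_one)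

theorem mulL_unitMode (j k : Fin 2 → ℤ) :
    mulL a (unitMode j) (unitMode k) = cocycle a j k • unitMode (j + k) := by
  rw [mulL, lift_unitMode, lift_unitMode]

theorem mulL_comm (f g : Wiener a) : mulL a f g = mulL a g f := by
  have h : mulL a = (mulL a).flip := by
    refine hom_ext fun j => hom_ext fun k => ?_
    rw [ContinuousLinearMap.flip_apply, mulL_unitMode, mulL_unitMode, cocycle, cocycle, add_comm j,
      mul_comm (weight a j : ℂ)]
  rw [h, ContinuousLinearMap.flip_apply, ← h]

/-- Both sides are trilinear and continuous, so modes suffice; there the claim is the 2-cocycle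
identity for `cocycle`, a coboundary of the weight. -/
theorem mulL_assoc (f g h : Wiener a) : mulL a (mulL a f g) h = mulL a f (mulL a g h) := by
  let compL := ContinuousLinearMap.compL ℂ (Wiener a) (Wiener a) (Wiener a)
  have key : (ContinuousLinearMap.compL ℂ (Wiener a) (Wiener a) (Wiener a →L[ℂ] Wiener a)
        (mulL a)).comp (mulL a) =
      (ContinuousLinearMap.compL ℂ (Wiener a) (Wiener a →L[ℂ] Wiener a)
        (Wiener a →L[ℂ] Wiener a)).flip (mulL a) ∘L (compL ∘L mulL a) := by
    refine hom_ext fun i => hom_ext fun j => hom_ext fun k => ?_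
    simp only [compL, ContinuousLinearMap.comp_apply, ContinuousLinearMap.flip_apply,
      ContinuousLinearMap.compL_apply, mulL_unitMode, map_smul, _root_.smul_apply,
      smul_smul, add_assoc]
    congr 1
    have := weight_ne_zero a
    simp only [cocycle, add_assoc]
    field_simp [this i, this j, this k, this (i + j), this (j + k)]
  have := congrArg (fun T => T f g h) key
  simpa [compL] using this

theorem mulL_one (f : Wiener a) : mulL a (unitMode 0) f = f := by
  have h : mulL a (unitMode 0) = ContinuousLinearMap.id ℂ (Wiener a) := by
    refine hom_ext fun k => ?_
    rw [mulL_unitMode, cocycle, weight_zero, zero_add, ofReal_one, one_mul,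
      div_self (weight_ne_zero a k), one_smul, ContinuousLinearMap.id_apply]
  rw [h, ContinuousLinearMap.id_apply]

instance : NormedCommRing (Wiener a) :=
  { (inferInstance : NormedAddCommGroup (Wiener a)) with
    mul := fun f g => mulL a f g
    one := unitMode 0
    left_distrib := fun f g h => map_add (mulL a f) g h
    right_distrib := fun f g h => by
      change mulL a (f + g) h = mulL a f h + mulL a g h
      rw [map_add, _root_.add_apply]
    zero_mul := fun f => by
      change mulL a 0 f = 0
      rw [map_zero, _root_.zero_apply]
    mul_zero := fun f => map_zero (mulL a f)
    mul_assoc := mulL_assoc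
    one_mul := mulL_one
    mul_one := fun f => (mulL_comm _ _).trans (mulL_one f)
    mul_comm := mulL_comm
    norm_mul_le := fun f g => by
      have h : ‖mulL a‖ ≤ 1 := norm_lift_le _ _ _ zero_le_one
      refine ((mulL a).le_opNorm₂ f g).trans ?_
      calc ‖mulL a‖ * ‖f‖ * ‖g‖ ≤ 1 * ‖f‖ * ‖g‖ := by gcongr
        _ = ‖f‖ * ‖g‖ := by rw [one_mul] }

theorem mul_def (f g : Wiener a) : f * g = mulL a f g := rfl

theorem one_def : (1 : Wiener a) = unitMode 0 := rfl

instance : Algebra ℂ (Wiener a) :=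
  Algebra.ofModule
    (fun c f g => by rw [mul_def, mul_def, map_smul, _root_.smul_apply])
    (fun c f g => by rw [mul_def, mul_def, map_smul])

instance : NormedAlgebra ℂ (Wiener a) where
  norm_smul_le := norm_smul_le

instance : NormOneClass (Wiener a) := ⟨norm_unitMode 0⟩

/-- The exponential `e^{ik·x}`. -/
def mode (k : Fin 2 → ℤ) : Wiener a := (weight a k : ℂ) • unitMode k

theorem norm_mode (k : Fin 2 → ℤ) : ‖(mode k : Wiener a)‖ = weight a k := by
  rw [mode, norm_smul, norm_unitMode, mul_one, norm_real, Real.norm_of_nonneg (weight_pos a k).le]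

/-- The `k`-th Fourier coefficient. -/
def coeff (f : Wiener a) (k : Fin 2 → ℤ) : ℂ :=
  (show lp (fun _ : Fin 2 → ℤ => ℂ) 1 from f) k / weight a k

theorem summable_norm_coeff_mul_weight (f : Wiener a) :
    Summable fun k => ‖coeff f k‖ * weight a k := by
  refine (summable_norm_l1 (J := Fin 2 → ℤ) f).congr fun k => ?_
  rw [coeff, norm_div, norm_real, Real.norm_of_nonneg (weight_pos a k).le,
    div_mul_cancel₀ _ (weight_pos a k).ne']

theorem norm_eq_tsum (f : Wiener a) : ‖f‖ = ∑' k, ‖coeff f k‖ * weight a k := by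
  refine (norm_l1_eq_tsum (J := Fin 2 → ℤ) f).trans (tsum_congr fun k => ?_)
  rw [coeff, norm_div, norm_real, Real.norm_of_nonneg (weight_pos a k).le,
    div_mul_cancel₀ _ (weight_pos a k).ne']

theorem hasSum_lift {E : Type*} [NormedAddCommGroup E] [NormedSpace ℂ E] [CompleteSpace E]
    (e : (Fin 2 → ℤ) → E) (C : ℝ) (he : ∀ j, ‖e j‖ ≤ C) (f : Wiener a) :
    HasSum (fun k => (coeff f k * weight a k) • e k) (lift e C he f) := by
  have h : HasSum (fun k => (show lp (fun _ : Fin 2 → ℤ => ℂ) 1 from f) k • e k) (lift e C he f) :=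
    hasSum_l1Lift e C he f
  convert h using 3 with k
  rw [coeff, div_mul_cancel₀ _ (weight_ne_zero a k)]

end Wiener

/-- The exponential `e^{ik·x}` on `ℝ²`. -/
def torusChar (k : Fin 2 → ℤ) (x : Fin 2 → ℝ) : ℂ := Complex.exp (I * ∑ i, (k i : ℂ) * (x i : ℂ))

theorem norm_torusChar (k : Fin 2 → ℤ) (x : Fin 2 → ℝ) : ‖torusChar k x‖ = 1 := by
  have : ∑ i, (k i : ℂ) * (x i : ℂ) = ((∑ i, (k i : ℝ) * x i : ℝ) : ℂ) := by push_cast; rfl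
  rw [torusChar, this, mul_comm, norm_exp_ofReal_mul_I]

theorem torusChar_add (j k : Fin 2 → ℤ) (x : Fin 2 → ℝ) :
    torusChar (j + k) x = torusChar j x * torusChar k x := by
  rw [torusChar, torusChar, torusChar, ← Complex.exp_add, ← mul_add, ← Finset.sum_add_distrib]
  simp [add_mul]

/-! ### Point evaluations, Fourier multipliers and coefficient functionals -/

namespace Wiener

variable {a : NNReal}

/-- Evaluation at a point as a continuous linear functional. -/
def evalL (x : Fin 2 → ℝ) : Wiener a →L[ℂ] ℂ :=
  lift (fun k => torusChar k x / weight a k) 1 fun k => by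
    rw [norm_div, norm_torusChar, norm_real, Real.norm_of_nonneg (weight_pos a k).le]
    exact div_le_one_of_le₀ (one_le_weight a k) (weight_pos a k).le

theorem hasSum_evalL (x : Fin 2 → ℝ) (f : Wiener a) :
    HasSum (fun k => coeff f k * torusChar k x) (evalL x f) := by
  have h : HasSum (fun k => (coeff f k * weight a k) • (torusChar k x / weight a k))
    (evalL x f) := hasSum_lift _ _ _ f
  convert h using 2 with k
  rw [smul_eq_mul, mul_assoc, mul_div_cancel₀ _ (weight_ne_zero a k)]

theorem evalL_mul (x : Fin 2 → ℝ) (f g : Wiener a) : evalL x (f * g) = evalL x f * evalL x g := by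
  have key : (ContinuousLinearMap.compL ℂ (Wiener a) (Wiener a) ℂ (evalL x)).comp (mulL a) =
      ((ContinuousLinearMap.mul ℂ ℂ).flip.comp (evalL x)).flip.comp (evalL x)  := by
    refine hom_ext fun j => hom_ext fun k => ?_
    have := weight_ne_zero a
    simp only [ContinuousLinearMap.comp_apply, ContinuousLinearMap.flip_apply,
      ContinuousLinearMap.compL_apply, mulL_unitMode, map_smul, ContinuousLinearMap.mul_apply',
      evalL, lift_unitMode, torusChar_add, cocycle, smul_eq_mul]
    field_simp [this j, this k, this (j + k)]
  have := congrArg (fun T => T f g) key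
  simpa [mul_def, mul_comm] using this

theorem evalL_one (x : Fin 2 → ℝ) : evalL x (1 : Wiener a) = 1 := by
  rw [one_def, evalL, lift_unitMode]
  simp [weight_zero, torusChar]

/-- Evaluation at a point as a character. -/
def eval (x : Fin 2 → ℝ) : Wiener a →ₐ[ℂ] ℂ :=
  AlgHom.ofLinearMap (evalL x : Wiener a →L[ℂ] ℂ).toLinearMap (evalL_one x) (evalL_mul x)

theorem evalL_eq_eval (x : Fin 2 → ℝ) (f : Wiener a) : evalL x f = eval x f := rfl

theorem hasSum_eval (x : Fin 2 → ℝ) (f : Wiener a) :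
    HasSum (fun k => coeff f k * torusChar k x) (eval x f) := hasSum_evalL x f

theorem norm_eval_le (x : Fin 2 → ℝ) (f : Wiener a) : ‖eval x f‖ ≤ ‖f‖ := by
  have h := (evalL x : Wiener a →L[ℂ] ℂ).le_of_opNorm_le (norm_lift_le _ _ _ zero_le_one) f
  rwa [one_mul] at h

theorem eval_mode (x : Fin 2 → ℝ) (k : Fin 2 → ℤ) :
    eval x (mode k : Wiener a) = torusChar k x := by
  rw [← evalL_eq_eval, mode, map_smul, evalL, lift_unitMode, smul_eq_mul,
    mul_div_cancel₀ _ (weight_ne_zero a k)]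

/-- The Fourier multiplier with symbol `m`. -/
def multiplier (m : (Fin 2 → ℤ) → ℂ) (C : ℝ) (hm : ∀ k, ‖m k‖ ≤ C) : Wiener a →L[ℂ] Wiener a :=
  lift (fun k => m k • unitMode k) C fun k => by
    rw [norm_smul, norm_unitMode, mul_one]
    exact hm k

theorem norm_multiplier_le (m : (Fin 2 → ℤ) → ℂ) (C : ℝ) (hm : ∀ k, ‖m k‖ ≤ C) (hC : 0 ≤ C) :
    ‖(multiplier m C hm : Wiener a →L[ℂ] Wiener a)‖ ≤ C := norm_lift_le _ _ _ hC

theorem multiplier_unitMode (m : (Fin 2 → ℤ) → ℂ) (C : ℝ) (hm : ∀ k, ‖m k‖ ≤ C) (k : Fin 2 → ℤ) :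
    multiplier m C hm (unitMode k : Wiener a) = m k • unitMode k := lift_unitMode _ _ _ _

/-- The `k`-th Fourier coefficient as a continuous linear functional. -/
def coeffL (k : Fin 2 → ℤ) : Wiener a →L[ℂ] ℂ :=
  (weight a k : ℂ)⁻¹ • lp.evalCLM ℂ (fun _ : Fin 2 → ℤ => ℂ) 1 k

theorem coeffL_apply (f : Wiener a) (k : Fin 2 → ℤ) : coeffL k f = coeff f k := by
  rw [coeff, div_eq_inv_mul]
  rfl

theorem coeff_unitMode (j k : Fin 2 → ℤ) :
    coeff (unitMode j : Wiener a) k = if j = k then (weight a k : ℂ)⁻¹ else 0 := by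
  rw [coeff]
  change (lp.single (E := fun _ => ℂ) 1 j (1 : ℂ)) k / _ = _
  split_ifs with h
  · rw [h, lp.single_apply_self, one_div]
  · rw [lp.single_apply_ne _ _ _ (Ne.symm h), zero_div]

theorem coeff_multiplier (m : (Fin 2 → ℤ) → ℂ) (C : ℝ) (hm : ∀ k, ‖m k‖ ≤ C) (f : Wiener a)
    (k : Fin 2 → ℤ) : coeff (multiplier m C hm f) k = m k * coeff f k := by
  have : (coeffL k).comp (multiplier m C hm) = m k • (coeffL k : Wiener a →L[ℂ] ℂ) := by
    refine hom_ext fun j => ?_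
    rw [ContinuousLinearMap.comp_apply, multiplier_unitMode, map_smul,
      _root_.smul_apply, coeffL_apply, coeff_unitMode]
    split_ifs with h
    · rw [h]
    · simp
  simpa [coeffL_apply] using congrArg (fun T => T f) this

end Wiener

/-! ### Cauchy integral functional calculus in a commutative Banach algebra -/

theorem continuousOn_section {A : Type*} [TopologicalSpace A] {G : ℂ → ℂ → A} {S : Set ℂ}
    (hG : ContinuousOn (Function.uncurry G) (S ×ˢ S)) {z : ℂ} (hz : z ∈ S) :
    ContinuousOn (G z) S :=
  hG.comp (f := fun w => (z, w)) (by fun_prop) fun _ hw => ⟨hz, hw⟩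

section CauchyCalculus

variable {A : Type*} [NormedCommRing A] [NormedAlgebra ℂ A] [CompleteSpace A] [NormOneClass A]

theorem mem_resolventSet_of_mem_sphere {v : A} (hv : ‖v‖ ≤ 1 / 2) {z : ℂ}
    (hz : z ∈ Metric.sphere (0 : ℂ) 1) : z ∈ resolventSet ℂ v := by
  rw [mem_sphere_zero_iff_norm] at hz
  refine spectrum.mem_resolventSet_of_norm_lt ?_
  rw [hz]
  linarith

theorem resolvent_mul_sub {v : A} (hv : ‖v‖ ≤ 1 / 2) {z : ℂ}
    (hz : z ∈ Metric.sphere (0 : ℂ) 1) : resolvent v z * (algebraMap ℂ A z - v) = 1 :=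
  Ring.inverse_mul_cancel _ (mem_resolventSet_of_mem_sphere hv hz)

/-- From z R = 1 + R v and |z| = 1 one gets ‖R‖ ≤ 1 + ‖R‖/2, which bounds R without summing the
Neumann series. -/
theorem norm_resolvent_le {v : A} (hv : ‖v‖ ≤ 1 / 2) {z : ℂ}
    (hz : z ∈ Metric.sphere (0 : ℂ) 1) : ‖resolvent v z‖ ≤ 2 := by
  have h := resolvent_mul_sub hv hz
  rw [mem_sphere_zero_iff_norm] at hz
  have h1 : z • resolvent v z = 1 + resolvent v z * v := by
    rw [← h, Algebra.smul_def]
    ring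
  have h2 : ‖resolvent v z‖ ≤ 1 + ‖resolvent v z‖ * (1 / 2) := by
    calc ‖resolvent v z‖ = ‖z • resolvent v z‖ := by rw [norm_smul, hz, one_mul]
      _ ≤ ‖(1 : A)‖ + ‖resolvent v z * v‖ := h1 ▸ norm_add_le _ _
      _ ≤ 1 + ‖resolvent v z‖ * (1 / 2) := by
        rw [norm_one]
        gcongr
        exact (norm_mul_le _ _).trans (by gcongr)
  linarith

theorem norm_resolvent_sub_le {v v' : A} (hv : ‖v‖ ≤ 1 / 2) (hv' : ‖v'‖ ≤ 1 / 2) {z : ℂ}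
    (hz : z ∈ Metric.sphere (0 : ℂ) 1) : ‖resolvent v z - resolvent v' z‖ ≤ 4 * ‖v - v'‖ := by
  have h := resolvent_mul_sub hv hz
  have h' := resolvent_mul_sub hv' hz
  have key : resolvent v z - resolvent v' z = resolvent v z * resolvent v' z * (v - v') := by
    linear_combination (-resolvent v z) * h' + resolvent v' z * h
  rw [key]
  calc _ ≤ ‖resolvent v z‖ * ‖resolvent v' z‖ * ‖v - v'‖ :=
        (norm_mul_le _ _).trans (by gcongr; exact norm_mul_le _ _)
    _ ≤ 2 * 2 * ‖v - v'‖ := by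
        gcongr
        exacts [norm_resolvent_le hv hz, norm_resolvent_le hv' hz]
    _ = 4 * ‖v - v'‖ := by ring

theorem continuousOn_resolvent {v : A} (hv : ‖v‖ ≤ 1 / 2) :
    ContinuousOn (resolvent v) (Metric.sphere (0 : ℂ) 1) := fun _ hz =>
  (spectrum.hasDerivAt_resolvent_const_left (mem_resolventSet_of_mem_sphere hv hz)).continuousAt
    |>.continuousWithinAt

theorem map_resolvent (χ : A →ₐ[ℂ] ℂ) {v : A} (hv : ‖v‖ ≤ 1 / 2) {z : ℂ}
    (hz : z ∈ Metric.sphere (0 : ℂ) 1) : χ (resolvent v z) = (z - χ v)⁻¹ := by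
  have h := congrArg χ (resolvent_mul_sub hv hz)
  rw [map_mul, map_sub, AlgHom.commutes, map_one] at h
  exact eq_inv_of_mul_eq_one_left h

/-- The Cauchy integral `(2πi)⁻¹ ∮ G(z) (z - v)⁻¹ dz` over the unit circle. -/
def cauchyCalc (G : ℂ → A) (v : A) : A :=
  (2 * Real.pi * I : ℂ)⁻¹ • ∮ z in C(0, 1), G z * resolvent v z

theorem circleIntegrable_cauchyCalc {G : ℂ → A} (hG : ContinuousOn G (Metric.sphere 0 1)) {v : A}
    (hv : ‖v‖ ≤ 1 / 2) : CircleIntegrable (fun z => G z * resolvent v z) 0 1 :=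
  (hG.mul (continuousOn_resolvent hv)).circleIntegrable zero_le_one

theorem norm_cauchyCalc_le {G : ℂ → A} {B : ℝ} (hB : ∀ z ∈ Metric.sphere (0 : ℂ) 1, ‖G z‖ ≤ B)
    {v : A} (hv : ‖v‖ ≤ 1 / 2) : ‖cauchyCalc G v‖ ≤ 2 * B := by
  refine (circleIntegral.norm_two_pi_i_inv_smul_integral_le_of_norm_le_const
    (C := B * 2) zero_le_one fun z hz => ?_).trans (by linarith)
  refine (norm_mul_le _ _).trans (mul_le_mul (hB z hz) (norm_resolvent_le hv hz)
    (norm_nonneg _) ((norm_nonneg _).trans (hB z hz)))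

theorem cauchyCalc_sub {G G' : ℂ → A} (hG : ContinuousOn G (Metric.sphere 0 1))
    (hG' : ContinuousOn G' (Metric.sphere 0 1)) {v : A} (hv : ‖v‖ ≤ 1 / 2) :
    cauchyCalc G v - cauchyCalc G' v = cauchyCalc (fun z => G z - G' z) v := by
  rw [cauchyCalc, cauchyCalc, cauchyCalc, ← smul_sub, ← circleIntegral.integral_sub
    (circleIntegrable_cauchyCalc hG hv) (circleIntegrable_cauchyCalc hG' hv)]
  simp only [sub_mul]

theorem norm_cauchyCalc_sub_le {G : ℂ → A} (hG : ContinuousOn G (Metric.sphere 0 1)) {B : ℝ}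
    (hB : ∀ z ∈ Metric.sphere (0 : ℂ) 1, ‖G z‖ ≤ B) {v v' : A} (hv : ‖v‖ ≤ 1 / 2)
    (hv' : ‖v'‖ ≤ 1 / 2) : ‖cauchyCalc G v - cauchyCalc G v'‖ ≤ 4 * B * ‖v - v'‖ := by
  rw [cauchyCalc, cauchyCalc, ← smul_sub, ← circleIntegral.integral_sub
    (circleIntegrable_cauchyCalc hG hv) (circleIntegrable_cauchyCalc hG hv')]
  refine (circleIntegral.norm_two_pi_i_inv_smul_integral_le_of_norm_le_const
    (C := B * (4 * ‖v - v'‖)) zero_le_one fun z hz => ?_).trans (by linarith)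
  rw [← mul_sub]
  exact (norm_mul_le _ _).trans (mul_le_mul (hB z hz) (norm_resolvent_sub_le hv hv' hz)
    (norm_nonneg _) ((norm_nonneg _).trans (hB z hz)))

/-- A character commutes with the integral and turns the resolvent into (z - χ(v))⁻¹. Since |χ(v)| ≤
‖v‖ < 1, the scalar Cauchy formula applies. -/
theorem map_cauchyCalc (χ : A →ₐ[ℂ] ℂ) {G : ℂ → A} (hG : ContinuousOn G (Metric.sphere 0 1))
    {v : A} (hv : ‖v‖ ≤ 1 / 2) {g : ℂ → ℂ} (hg : DiffContOnCl ℂ g (Metric.ball 0 1))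
    (hχ : ∀ z ∈ Metric.sphere (0 : ℂ) 1, χ (G z) = g z) : χ (cauchyCalc G v) = g (χ v) := by
  have hint : χ (∮ z in C(0, 1), G z * resolvent v z) =
      ∮ z in C(0, 1), χ (G z * resolvent v z) := by
    have h := (χ.toContinuousLinearMap).intervalIntegral_comp_comm
      (circleIntegrable_cauchyCalc hG hv).out
    simp only [circleIntegral]
    rw [← AlgHom.coe_toContinuousLinearMap, ← h]
    simp
  have hw : χ v ∈ Metric.ball (0 : ℂ) 1 := by
    rw [mem_ball_zero_iff]
    refine (AlgHom.norm_apply_le_self χ v).trans_lt ?_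
    linarith
  have hc := hg.circleIntegral_sub_inv_smul hw
  rw [cauchyCalc, map_smul, hint, circleIntegral.integral_congr zero_le_one
    (g := fun z => (z - χ v)⁻¹ • g z) fun z hz => ?_, hc, smul_smul, inv_mul_cancel₀, one_smul]
  · exact Complex.two_pi_I_ne_zero
  · simp only [map_mul, map_resolvent χ hv hz, hχ z hz, smul_eq_mul, mul_comm]

/-- This makes the inner integral an admissible integrand for the outer one. -/
theorem continuousOn_cauchyCalc {G : ℂ → ℂ → A}
    (hG : ContinuousOn (Function.uncurry G) (Metric.sphere 0 1 ×ˢ Metric.sphere 0 1)) {v : A}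
    (hv : ‖v‖ ≤ 1 / 2) :
    ContinuousOn (fun z => cauchyCalc (G z) v) (Metric.sphere (0 : ℂ) 1) := by
  rw [continuousOn_iff_continuous_domRestrict]
  refine Continuous.const_smul
    (intervalIntegral.continuous_parametric_intervalIntegral_of_continuous'
    (f := fun (z : Metric.sphere (0 : ℂ) 1) θ => deriv (circleMap 0 1) θ •
      (G z (circleMap 0 1 θ) * resolvent v (circleMap 0 1 θ))) ?_ _ _) _
  have hmem : ∀ θ, circleMap (0 : ℂ) 1 θ ∈ Metric.sphere (0 : ℂ) 1 := fun θ =>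
    circleMap_mem_sphere _ zero_le_one θ
  have h1 : Continuous fun p : Metric.sphere (0 : ℂ) 1 × ℝ => G p.1 (circleMap 0 1 p.2) :=
    hG.comp_continuous (f := fun p : Metric.sphere (0 : ℂ) 1 × ℝ => ((p.1 : ℂ), circleMap 0 1 p.2))
      (by fun_prop) fun p => ⟨p.1.2, hmem p.2⟩
  have h2 : Continuous fun p : Metric.sphere (0 : ℂ) 1 × ℝ => resolvent v (circleMap 0 1 p.2) :=
    (continuousOn_resolvent hv).comp_continuous (by fun_prop) fun p => hmem p.2
  have h3 : Continuous fun p : Metric.sphere (0 : ℂ) 1 × ℝ => deriv (circleMap 0 1) p.2 := by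
    simp only [deriv_circleMap]
    fun_prop
  exact h3.smul (h1.mul h2)

/-- The iterated Cauchy integral over the torus `|z₀| = |z₁| = 1`. -/
def cauchyCalc₂ (G : ℂ → ℂ → A) (v : Fin 2 → A) : A :=
  cauchyCalc (fun z => cauchyCalc (G z) (v 1)) (v 0)

section

variable {G : ℂ → ℂ → A} {B : ℝ} {v v' : Fin 2 → A}

theorem norm_cauchyCalc₂_le
    (hB : ∀ z ∈ Metric.sphere (0 : ℂ) 1, ∀ w ∈ Metric.sphere (0 : ℂ) 1, ‖G z w‖ ≤ B)
    (hv : ‖v‖ ≤ 1 / 2) : ‖cauchyCalc₂ G v‖ ≤ 4 * B := by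
  refine (norm_cauchyCalc_le (B := 2 * B) (fun z hz => ?_) ((norm_le_pi_norm v 0).trans hv)).trans
    (by linarith)
  exact norm_cauchyCalc_le (hB z hz) ((norm_le_pi_norm v 1).trans hv)

/-- The two arguments are changed one at a time, and each change costs 8B. -/
theorem norm_cauchyCalc₂_sub_le
    (hG : ContinuousOn (Function.uncurry G) (Metric.sphere 0 1 ×ˢ Metric.sphere 0 1))
    (hB : ∀ z ∈ Metric.sphere (0 : ℂ) 1, ∀ w ∈ Metric.sphere (0 : ℂ) 1, ‖G z w‖ ≤ B)
    (hv : ‖v‖ ≤ 1 / 2) (hv' : ‖v'‖ ≤ 1 / 2) :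
    ‖cauchyCalc₂ G v - cauchyCalc₂ G v'‖ ≤ 16 * B * ‖v - v'‖ := by
  have hn := fun i => (norm_le_pi_norm v i).trans hv
  have hn' := fun i => (norm_le_pi_norm v' i).trans hv'
  have hB0 : 0 ≤ B := (norm_nonneg _).trans (hB 1 (by simp) 1 (by simp))
  have hc := fun i => continuousOn_cauchyCalc hG (hn i)
  have hc' := continuousOn_cauchyCalc hG (hn' 1)
  have e1 : ‖cauchyCalc₂ G v - cauchyCalc (fun z => cauchyCalc (G z) (v 1)) (v' 0)‖ ≤
      4 * (2 * B) * ‖v 0 - v' 0‖ :=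
    norm_cauchyCalc_sub_le (hc 1) (fun z hz => norm_cauchyCalc_le (hB z hz) (hn 1)) (hn 0) (hn' 0)
  have e2 : ‖cauchyCalc (fun z => cauchyCalc (G z) (v 1)) (v' 0) - cauchyCalc₂ G v'‖ ≤
      2 * (4 * B * ‖v 1 - v' 1‖) := by
    rw [cauchyCalc₂, cauchyCalc_sub (hc 1) hc' (hn' 0)]
    exact norm_cauchyCalc_le (fun z hz => norm_cauchyCalc_sub_le (continuousOn_section hG hz)
      (hB z hz) (hn 1) (hn' 1)) (hn' 0)
  have f0 : ‖v 0 - v' 0‖ ≤ ‖v - v'‖ := norm_le_pi_norm (v - v') 0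
  have f1 : ‖v 1 - v' 1‖ ≤ ‖v - v'‖ := norm_le_pi_norm (v - v') 1
  calc _ ≤ 4 * (2 * B) * ‖v 0 - v' 0‖ + 2 * (4 * B * ‖v 1 - v' 1‖) :=
        (norm_sub_le_norm_sub_add_norm_sub _ _ _).trans (add_le_add e1 e2)
    _ ≤ 4 * (2 * B) * ‖v - v'‖ + 2 * (4 * B * ‖v - v'‖) := by gcongr
    _ = 16 * B * ‖v - v'‖ := by ring

theorem map_cauchyCalc₂ (χ : A →ₐ[ℂ] ℂ)
    (hG : ContinuousOn (Function.uncurry G) (Metric.sphere 0 1 ×ˢ Metric.sphere 0 1))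
    (hv : ‖v‖ ≤ 1 / 2) {g : ℂ → ℂ → ℂ}
    (hg₁ : ∀ z ∈ Metric.sphere (0 : ℂ) 1, DiffContOnCl ℂ (g z) (Metric.ball 0 1))
    (hg₀ : ∀ w ∈ Metric.ball (0 : ℂ) 1, DiffContOnCl ℂ (fun z => g z w) (Metric.ball 0 1))
    (hχ : ∀ z ∈ Metric.sphere (0 : ℂ) 1, ∀ w ∈ Metric.sphere (0 : ℂ) 1, χ (G z w) = g z w) :
    χ (cauchyCalc₂ G v) = g (χ (v 0)) (χ (v 1)) := by
  have hn := fun i => (norm_le_pi_norm v i).trans hv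
  have hw : χ (v 1) ∈ Metric.ball (0 : ℂ) 1 := by
    rw [mem_ball_zero_iff]
    refine (AlgHom.norm_apply_le_self χ _).trans_lt ?_
    linarith [hn 1]
  exact map_cauchyCalc χ (continuousOn_cauchyCalc hG (hn 1)) (hn 0) (hg₀ _ hw) fun z hz =>
    map_cauchyCalc χ (continuousOn_section hG hz) (hn 1) (hg₁ z hz) (hχ z hz)

end

end CauchyCalculus

/-! ### Second order Taylor estimate for polynomials in a commutative Banach algebra -/

section PolynomialTaylor

open MvPolynomial

variable {σ : Type*} [Fintype σ]

/-- Linearizing the difference at a third point ξ yields a Lipschitz estimate for the Taylor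
remainder with a small constant near ξ, as the contraction requires. The size and Lipschitz bounds
are proved along with it because multiplying by a variable in the induction uses them. -/
theorem exists_norm_aeval_sub_sub_le (A : Type*) [NormedCommRing A] [NormedAlgebra ℂ A]
    [NormOneClass A] (P : MvPolynomial σ ℂ) (R : ℝ) (hR : 0 ≤ R) :
    ∃ C : ℝ, 0 ≤ C ∧ ∀ u u' ξ : σ → A, ‖u‖ ≤ R → ‖u'‖ ≤ R → ‖ξ‖ ≤ R →
      ‖aeval u P‖ ≤ C ∧ ‖aeval u P - aeval u' P‖ ≤ C * ‖u - u'‖ ∧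
      ‖∑ i, aeval ξ (pderiv i P) * (u i - u' i)‖ ≤ C * ‖u - u'‖ ∧
      ‖aeval u P - aeval u' P - ∑ i, aeval ξ (pderiv i P) * (u i - u' i)‖ ≤
        C * (‖u - ξ‖ + ‖u' - ξ‖) * ‖u - u'‖ := by
  classical
  induction P using MvPolynomial.induction_on with
  | C c =>
    refine ⟨‖c‖, norm_nonneg _, fun u u' ξ _ _ _ => ?_⟩
    simp only [aeval_C, pderiv_C, sub_self, map_zero, zero_mul, Finset.sum_const_zero, norm_zero,
      norm_algebraMap']
    exact ⟨le_rfl, by positivity, by positivity, by positivity⟩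
  | add P Q hP hQ =>
    obtain ⟨C, hC, hP⟩ := hP
    obtain ⟨D, hD, hQ⟩ := hQ
    refine ⟨C + D, by positivity, fun u u' ξ hu hu' hξ => ?_⟩
    obtain ⟨p1, p2, p3, p4⟩ := hP u u' ξ hu hu' hξ
    obtain ⟨q1, q2, q3, q4⟩ := hQ u u' ξ hu hu' hξ
    simp only [map_add, add_mul, Finset.sum_add_distrib]
    refine ⟨norm_add_le_of_le p1 q1, ?_, norm_add_le_of_le p3 q3, ?_⟩
    · rw [add_sub_add_comm]
      exact norm_add_le_of_le p2 q2
    · rw [add_sub_add_comm, add_sub_add_comm]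
      exact norm_add_le_of_le p4 q4
  | mul_X P j hP =>
    obtain ⟨C, hC, hP⟩ := hP
    refine ⟨2 * C * R + 2 * C, by positivity, fun u u' ξ hu hu' hξ => ?_⟩
    obtain ⟨p1, p2, p3, p4⟩ := hP u u' ξ hu hu' hξ
    obtain ⟨-, s2, -, -⟩ := hP u' ξ ξ hu' hξ hξ
    obtain ⟨r1, -, -, -⟩ := hP ξ ξ ξ hξ hξ hξ
    have hj : ‖u j‖ ≤ R := (norm_le_pi_norm u j).trans hu
    have hj' : ‖u' j‖ ≤ R := (norm_le_pi_norm u' j).trans hu'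
    have hξj : ‖ξ j‖ ≤ R := (norm_le_pi_norm ξ j).trans hξ
    have hd : ‖u j - u' j‖ ≤ ‖u - u'‖ := norm_le_pi_norm (u - u') j
    have he : ‖u j - ξ j‖ ≤ ‖u - ξ‖ := norm_le_pi_norm (u - ξ) j
    have hsum : ∑ i, aeval ξ (pderiv i (P * X j)) * (u i - u' i) =
        (∑ i, aeval ξ (pderiv i P) * (u i - u' i)) * ξ j + aeval ξ P * (u j - u' j) := by
      simp only [pderiv_mul, pderiv_X, map_add, map_mul, aeval_X, add_mul, Finset.sum_add_distrib,
        Finset.sum_mul]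
      congr 1
      · exact Finset.sum_congr rfl fun i _ => by ring
      · rw [Finset.sum_eq_single j]
        · simp
        · intro i _ hi
          simp [hi.symm]
        · simp
    have hnn : 0 ≤ ‖u - u'‖ := norm_nonneg _
    rw [hsum, map_mul, map_mul, aeval_X, aeval_X]
    set L := ∑ i, aeval ξ (pderiv i P) * (u i - u' i)
    refine ⟨?_, ?_, ?_, ?_⟩
    · calc _ ≤ ‖aeval u P‖ * ‖u j‖ := norm_mul_le _ _
        _ ≤ C * R := by gcongr
        _ ≤ _ := by nlinarith [mul_nonneg hC hR]
    · have : aeval u P * u j - aeval u' P * u' j =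
          (aeval u P - aeval u' P) * u' j + aeval u P * (u j - u' j) := by ring
      rw [this]
      calc _ ≤ ‖aeval u P - aeval u' P‖ * ‖u' j‖ + ‖aeval u P‖ * ‖u j - u' j‖ :=
            norm_add_le_of_le (norm_mul_le _ _) (norm_mul_le _ _)
        _ ≤ C * ‖u - u'‖ * R + C * ‖u - u'‖ := by gcongr
        _ ≤ _ := by nlinarith [mul_nonneg (mul_nonneg hC hR) hnn, mul_nonneg hC hnn]
    · calc _ ≤ ‖L‖ * ‖ξ j‖ + ‖aeval ξ P‖ * ‖u j - u' j‖ :=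
            norm_add_le_of_le (norm_mul_le _ _) (norm_mul_le _ _)
        _ ≤ C * ‖u - u'‖ * R + C * ‖u - u'‖ := by gcongr
        _ ≤ _ := by nlinarith [mul_nonneg (mul_nonneg hC hR) hnn, mul_nonneg hC hnn]
    -- The three terms are: the remainder of P, and two products of a Lipschitz difference with a
    -- difference of variables, hence already of second order.
    · have : aeval u P * u j - aeval u' P * u' j - (L * ξ j + aeval ξ P * (u j - u' j)) =
          (aeval u P - aeval u' P - L) * ξ j + (aeval u P - aeval u' P) * (u j - ξ j) +
            (aeval u' P - aeval ξ P) * (u j - u' j) := by ring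
      rw [this]
      calc _ ≤ ‖aeval u P - aeval u' P - L‖ * ‖ξ j‖ +
            ‖aeval u P - aeval u' P‖ * ‖u j - ξ j‖ +
            ‖aeval u' P - aeval ξ P‖ * ‖u j - u' j‖ :=
            norm_add_le_of_le (norm_add_le_of_le (norm_mul_le _ _) (norm_mul_le _ _))
              (norm_mul_le _ _)
        _ ≤ C * (‖u - ξ‖ + ‖u' - ξ‖) * ‖u - u'‖ * R + C * ‖u - u'‖ * ‖u - ξ‖ +
            C * ‖u' - ξ‖ * ‖u - u'‖ := by gcongr
        _ = (C * R + C) * ((‖u - ξ‖ + ‖u' - ξ‖) * ‖u - u'‖) := by ring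
        _ ≤ (2 * C * R + 2 * C) * ((‖u - ξ‖ + ‖u' - ξ‖) * ‖u - u'‖) := by
            gcongr
            · nlinarith [mul_nonneg hC hR]
            · linarith
        _ = _ := by ring

end PolynomialTaylor

/-! ### Fourier series of periodic functions of one and two real variables -/

/-- The Fourier coefficient `(2π)⁻¹ ∫₀^{2π} e^{-ikx} g(x) dx`. -/
def circleCoeff (g : ℝ → ℂ) (k : ℤ) : ℂ :=
  (2 * Real.pi : ℂ)⁻¹ * ∫ x in (0 : ℝ)..2 * Real.pi, Complex.exp (-(I * (k * x))) * g x

theorem norm_exp_neg_I_mul (k : ℤ) (x : ℝ) : ‖Complex.exp (-(I * (k * x)))‖ = 1 := by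
  have : -(I * (k * x)) = ((-(k * x) : ℝ) : ℂ) * I := by push_cast; ring
  rw [this, norm_exp_ofReal_mul_I]

theorem norm_circleCoeff_le {g : ℝ → ℂ} {B : ℝ} (hB : ∀ x, ‖g x‖ ≤ B) (k : ℤ) :
    ‖circleCoeff g k‖ ≤ B := by
  have h : ‖∫ x in (0 : ℝ)..2 * Real.pi, Complex.exp (-(I * (k * x))) * g x‖ ≤
      B * |2 * Real.pi - 0| := intervalIntegral.norm_integral_le_of_norm_le_const fun x _ => by
    rw [norm_mul, norm_exp_neg_I_mul, one_mul]
    exact hB x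
  have hpi := Real.two_pi_pos
  have hn : ‖(2 * Real.pi : ℂ)⁻¹‖ = (2 * Real.pi)⁻¹ := by
    rw [norm_inv, ← ofReal_ofNat, ← ofReal_mul, norm_real, Real.norm_of_nonneg hpi.le]
  rw [sub_zero, abs_of_pos hpi] at h
  rw [circleCoeff, norm_mul, hn, inv_mul_le_iff₀ hpi]
  linarith

theorem hasSum_circleCoeff {g : ℝ → ℂ} (hg : Continuous g)
    (hper : Function.Periodic g (2 * Real.pi)) (hs : Summable fun k => ‖circleCoeff g k‖) (x : ℝ) :
    HasSum (fun k : ℤ => circleCoeff g k * Complex.exp (I * (k * x))) (g x) := by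
  have : Fact (0 < 2 * Real.pi) := ⟨Real.two_pi_pos⟩
  have hpi : (Real.pi : ℂ) ≠ 0 := ofReal_ne_zero.mpr Real.pi_ne_zero
  let G : C(AddCircle (2 * Real.pi), ℂ) := ⟨hper.lift, hg.quotient_liftOn' _⟩
  have hG : ∀ k : ℤ, fourierCoeff G k = circleCoeff g k := fun k => by
    rw [fourierCoeff_eq_intervalIntegral _ _ 0, zero_add, circleCoeff, real_smul]
    congr 1
    · push_cast
      rw [one_div]
    · refine intervalIntegral.integral_congr fun y _ => ?_
      simp only [fourier_coe_apply, smul_eq_mul]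
      congr 2
      push_cast
      field_simp
  have hs' : Summable (fourierCoeff G) := by
    refine Summable.of_norm (hs.congr fun k => ?_)
    rw [hG]
  have h := has_pointwise_sum_fourier_series_of_summable hs' (x : AddCircle (2 * Real.pi))
  have hx : G x = g x := hper.lift_coe x
  rw [hx] at h
  refine (funext fun k => ?_ : (fun k : ℤ => circleCoeff g k * Complex.exp (I * (k * x))) =
    fun k => fourierCoeff G k • fourier k (x : AddCircle (2 * Real.pi))) ▸ h
  rw [hG, fourier_coe_apply, smul_eq_mul]
  congr 2
  push_cast
  field_simp

theorem continuous_circleCoeff {X : Type*} [TopologicalSpace X] {F : X → ℝ → ℂ}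
    (hF : Continuous (Function.uncurry F)) (k : ℤ) : Continuous fun p => circleCoeff (F p) k := by
  refine continuous_const.mul
    (intervalIntegral.continuous_parametric_intervalIntegral_of_continuous' (f := fun p (x : ℝ) =>
      Complex.exp (-(I * (k * x))) * F p x) ?_ _ _)
  exact Continuous.mul (by fun_prop) hF

theorem circleCoeff_const_mul (c : ℂ) (g : ℝ → ℂ) (k : ℤ) :
    circleCoeff (fun x => c * g x) k = c * circleCoeff g k := by
  simp only [circleCoeff, mul_left_comm _ c, intervalIntegral.integral_const_mul]

theorem circleCoeff_swap {F : ℝ → ℝ → ℂ} (hF : Continuous (Function.uncurry F)) (k l : ℤ) :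
    circleCoeff (fun x => circleCoeff (F x) l) k =
      circleCoeff (fun y => circleCoeff (fun x => F x y) k) l := by
  simp only [circleCoeff, ← intervalIntegral.integral_const_mul]
  rw [intervalIntegral_intervalIntegral_swap]
  · simp only [mul_left_comm]
  · have : Continuous (Function.uncurry fun x y : ℝ => (2 * Real.pi : ℂ)⁻¹ *
        (Complex.exp (-(I * (k * x))) *
          ((2 * Real.pi : ℂ)⁻¹ * (Complex.exp (-(I * (l * y))) * F x y)))) := by
      have hF' : Continuous fun p : ℝ × ℝ => F p.1 p.2 := hF
      simp only [Function.uncurry_def]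
      fun_prop
    exact (this.continuousOn.integrableOn_compact (isCompact_uIcc.prod isCompact_uIcc)).mono_set
      (Set.prod_mono Set.uIoc_subset_uIcc Set.uIoc_subset_uIcc)

/-- A contour shift for a periodic holomorphic function on a strip. -/
theorem integral_eq_integral_add_mul_I {h : ℂ → ℂ} {κ t : ℝ}
    (hd : DifferentiableOn ℂ h {z | |z.im| < κ})
    (hper : ∀ z : ℂ, |z.im| < κ → h (z + 2 * Real.pi) = h z) (ht : |t| < κ) :
    ∫ x in (0 : ℝ)..2 * Real.pi, h x = ∫ x in (0 : ℝ)..2 * Real.pi, h (x + t * I) := by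
  have H := Complex.integral_boundary_rect_eq_zero_of_differentiableOn h 0
    ((2 * Real.pi : ℝ) + t * I) (hd.mono ?_)
  · have hv : ∫ y in (0 : ℝ)..t, h ((2 * Real.pi : ℝ) + y * I) = ∫ y in (0 : ℝ)..t, h (y * I) := by
      refine intervalIntegral.integral_congr fun y hy => ?_
      have hy' : |y| < κ := by
        have := Set.abs_sub_left_of_mem_uIcc hy
        simp only [sub_zero] at this
        exact this.trans_lt ht
      have := hper (y * I) (by simpa using hy')
      rw [← this, add_comm]
      push_cast
      rfl
    simp only [zero_re, zero_im, add_re, add_im, mul_re, mul_im, ofReal_re, ofReal_im, I_re, I_im,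
      mul_zero, mul_one, sub_zero, zero_add, add_zero, ofReal_zero, zero_mul] at H
    rw [hv, add_sub_assoc, sub_self, add_zero, sub_eq_zero] at H
    exact H
  · intro z hz
    have := Set.abs_sub_left_of_mem_uIcc hz.2
    simp at this
    exact this.trans_lt ht

/-- The contour shift is applied to e^{-ikz}h(z), which is still periodic as k is an integer; on the
shifted line the exponential contributes e^{kt}. -/
theorem circleCoeff_eq_exp_mul {h : ℂ → ℂ} {κ t : ℝ}
    (hd : DifferentiableOn ℂ h {z | |z.im| < κ})
    (hper : ∀ z : ℂ, |z.im| < κ → h (z + 2 * Real.pi) = h z) (ht : |t| < κ) (k : ℤ) :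
    circleCoeff (fun x => h x) k =
      (Real.exp (k * t) : ℂ) * circleCoeff (fun x => h (x + t * I)) k := by
  have := integral_eq_integral_add_mul_I (h := fun z => Complex.exp (-(I * (k * z))) * h z)
    (κ := κ) (t := t) ?_ ?_ ht
  · rw [circleCoeff, this, circleCoeff, mul_left_comm]
    congr 1
    rw [← intervalIntegral.integral_const_mul]
    refine intervalIntegral.integral_congr fun x _ => ?_
    rw [← mul_assoc (Real.exp _ : ℂ), ofReal_exp, ← Complex.exp_add]
    congr 2
    push_cast
    linear_combination (-(k : ℂ) * t) * I_sq
  · exact DifferentiableOn.mul (by fun_prop) hd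
  · intro z hz
    rw [hper z hz]
    congr 1
    have : -(I * (k * (z + 2 * Real.pi))) =
        -(I * (k * z)) + ((-k : ℤ) : ℂ) * (2 * Real.pi * I) := by
      push_cast
      ring
    rw [this, Complex.exp_add, exp_int_mul_two_pi_mul_I, mul_one]

/-- The Fourier coefficient of a function of two real variables, as an iterated integral. -/
def torusCoeff (F : ℝ → ℝ → ℂ) (k : Fin 2 → ℤ) : ℂ :=
  circleCoeff (fun x => circleCoeff (F x) (k 1)) (k 0)

/-- One-dimensional inversion is used twice: first in x₀ for each inner coefficient, then in x₁.
Absolute summability lets the double series be summed by fibres. -/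
theorem hasSum_torusCoeff {F : ℝ → ℝ → ℂ} (hF : Continuous (Function.uncurry F))
    (hper₀ : ∀ y, Function.Periodic (fun x => F x y) (2 * Real.pi))
    (hper₁ : ∀ x, Function.Periodic (F x) (2 * Real.pi))
    (hs : Summable fun k => ‖torusCoeff F k‖) (x : Fin 2 → ℝ) :
    HasSum (fun k => torusCoeff F k * torusChar k x) (F (x 0) (x 1)) := by
  -- The swap puts k₁ in the first slot, so that the fibres run over k₀.
  let e := (Equiv.prodComm ℤ ℤ).trans (finTwoArrowEquiv ℤ).symm
  have hs1 : Summable fun p : ℤ × ℤ => ‖torusCoeff F (e p)‖ := e.summable_iff.mpr hs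
  have hG : ∀ l, Continuous fun x => circleCoeff (F x) l := fun l => continuous_circleCoeff hF l
  have hGper : ∀ l, Function.Periodic (fun x => circleCoeff (F x) l) (2 * Real.pi) := fun l x => by
    have : F (x + 2 * Real.pi) = F x := funext fun y => hper₀ y x
    simp only [this]
  have hfib : ∀ l, Summable fun k => ‖torusCoeff F (e (l, k))‖ := fun l => hs1.prod_factor l
  have hGsum : ∀ l, HasSum (fun k : ℤ => torusCoeff F (e (l, k)) * Complex.exp (I * (k * x 0)))
      (circleCoeff (F (x 0)) l) := fun l => hasSum_circleCoeff (hG l) (hGper l) (hfib l) (x 0)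
  have hexp : ∀ (k : ℤ) (t : ℝ), ‖Complex.exp (I * (k * t))‖ = 1 := fun k t => by
    have : I * (k * t) = ((k * t : ℝ) : ℂ) * I := by push_cast; ring
    rw [this, norm_exp_ofReal_mul_I]
  have hGnorm : Summable fun l => ‖circleCoeff (F (x 0)) l‖ := by
    refine Summable.of_nonneg_of_le (fun _ => norm_nonneg _) (fun l => ?_) hs1.prod
    rw [← (hGsum l).tsum_eq]
    have hn : (fun k : ℤ => ‖torusCoeff F (e (l, k)) * Complex.exp (I * (k * x 0))‖) =
        fun k => ‖torusCoeff F (e (l, k))‖ := funext fun k => by rw [norm_mul, hexp, mul_one]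
    refine (norm_tsum_le_tsum_norm (hn ▸ hfib l)).trans ?_
    rw [hn]
  have hout := hasSum_circleCoeff (g := F (x 0)) (hF.comp (by fun_prop : Continuous fun y : ℝ =>
    (x 0, y))) (hper₁ _) hGnorm (x 1)
  have hs2 : Summable fun p : ℤ × ℤ => torusCoeff F (e p) * torusChar (e p) x := by
    refine Summable.of_norm (hs1.congr fun p => ?_)
    rw [norm_mul, norm_torusChar, mul_one]
  rw [← e.hasSum_iff]
  refine (hs2.hasSum.prod_fiberwise fun l => ?_).unique hout ▸ hs2.hasSum
  have h := (hGsum l).mul_right (Complex.exp (I * (l * x 1)))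
  refine (funext fun k => ?_ : (fun k => torusCoeff F (e (l, k)) * torusChar (e (l, k)) x) =
    fun k => torusCoeff F (e (l, k)) * Complex.exp (I * (k * x 0)) *
      Complex.exp (I * (l * x 1))) ▸ h
  rw [mul_assoc, ← Complex.exp_add, torusChar, Fin.sum_univ_two, mul_add]
  rfl

theorem summable_exp_neg_mul_abs {b : ℝ} (hb : 0 < b) :
    Summable fun n : ℤ => Real.exp (-(b * |(n : ℝ)|)) := by
  have h : Summable fun n : ℕ => Real.exp (-(b * n)) := by
    have := summable_geometric_of_lt_one (Real.exp_pos (-b)).le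
      (Real.exp_lt_one_iff.mpr (neg_lt_zero.mpr hb))
    refine this.congr fun n => ?_
    rw [← Real.exp_nat_mul]
    congr 1
    ring
  rw [summable_int_iff_summable_nat_and_neg]
  constructor <;> simpa using h

theorem summable_exp_neg_mul_freqLength {b : ℝ} (hb : 0 < b) :
    Summable fun k : Fin 2 → ℤ => Real.exp (-(b * freqLength k)) := by
  have h := summable_exp_neg_mul_abs hb
  rw [← (finTwoArrowEquiv ℤ).symm.summable_iff]
  refine (h.mul_of_nonneg h (fun _ => (Real.exp_pos _).le) fun _ => (Real.exp_pos _).le).congr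
    fun p => ?_
  rw [Function.comp_apply, ← Real.exp_add, freqLength, Fin.sum_univ_two]
  congr 1
  simp [finTwoArrowEquiv]
  ring

/-! ### Holomorphic functions on a neighbourhood of the torus -/

theorem exists_shift (b : ℝ) (hb : 0 ≤ b) (k : ℤ) :
    ∃ t : ℝ, |t| = b ∧ k * t = -(b * |(k : ℝ)|) := by
  rcases le_total 0 (k : ℝ) with h | h
  · exact ⟨-b, by rw [abs_neg, abs_of_nonneg hb], by rw [abs_of_nonneg h]; ring⟩
  · exact ⟨b, abs_of_nonneg hb, by rw [abs_of_nonpos h]; ring⟩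

/-- The strip `|Im z₀|, |Im z₁| < κ`. -/
def strip₂ (κ : ℝ) : Set (ℂ × ℂ) := {z | |z.1.im| < κ ∧ |z.2.im| < κ}

theorem norm_torusCoeff_le {h : ℂ → ℂ → ℂ} {κ b B : ℝ}
    (hd : DifferentiableOn ℂ (Function.uncurry h) (strip₂ κ))
    (hper₀ : ∀ z w : ℂ, |z.im| < κ → |w.im| < κ → h (z + 2 * Real.pi) w = h z w)
    (hper₁ : ∀ z w : ℂ, |z.im| < κ → |w.im| < κ → h z (w + 2 * Real.pi) = h z w)
    (hB : ∀ z w : ℂ, |z.im| < κ → |w.im| < κ → ‖h z w‖ ≤ B) (hb : 0 ≤ b) (hbκ : b < κ)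
    (k : Fin 2 → ℤ) :
    ‖torusCoeff (fun x y => h x y) k‖ ≤ B * Real.exp (-(b * freqLength k)) := by
  -- Each variable is shifted in the direction, depending on the sign of its frequency, that gains
  -- e^{-b|k_i|}.
  obtain ⟨t, ht, hkt⟩ := exists_shift b hb (k 0)
  obtain ⟨s, hs, hks⟩ := exists_shift b hb (k 1)
  have hκ : 0 < κ := hb.trans_lt hbκ
  have e1 : ∀ x : ℝ, circleCoeff (fun y : ℝ => h x y) (k 1) =
      (Real.exp (k 1 * s) : ℂ) * circleCoeff (fun y : ℝ => h x (y + s * I)) (k 1) := fun x =>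
    circleCoeff_eq_exp_mul (κ := κ)
      (hd.comp (f := fun w : ℂ => ((x : ℂ), w)) (by fun_prop) fun w hw => ⟨by simpa using hκ, hw⟩)
      (fun w hw => hper₁ x w (by simpa using hκ) hw) (hs ▸ hbκ) _
  have e2 : ∀ y : ℝ, circleCoeff (fun x : ℝ => h x (y + s * I)) (k 0) =
      (Real.exp (k 0 * t) : ℂ) * circleCoeff (fun x : ℝ => h (x + t * I) (y + s * I)) (k 0) :=
    fun y => circleCoeff_eq_exp_mul (h := fun z => h z (y + s * I)) (κ := κ)
      (hd.comp (f := fun z : ℂ => (z, (y + s * I : ℂ))) (by fun_prop)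
        fun z hz => ⟨hz, by simpa using hs ▸ hbκ⟩)
      (fun z hz => hper₀ z _ hz (by simpa using hs ▸ hbκ)) (ht ▸ hbκ) _
  have hc : Continuous (Function.uncurry fun x y : ℝ => h x (y + s * I)) :=
    hd.continuousOn.comp_continuous
      (f := fun p : ℝ × ℝ => ((p.1 : ℂ), (p.2 + s * I : ℂ))) (by fun_prop)
      fun p => ⟨by simpa using hκ, by simpa using hs ▸ hbκ⟩
  have hfin : torusCoeff (fun x y => h x y) k =
      (Real.exp (k 1 * s) : ℂ) * ((Real.exp (k 0 * t) : ℂ) * circleCoeff (fun y : ℝ =>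
        circleCoeff (fun x : ℝ => h (x + t * I) (y + s * I)) (k 0)) (k 1)) := by
    simp only [torusCoeff, e1, circleCoeff_const_mul]
    -- After the shift in the inner variable the order of integration is exchanged, so that the
    -- other variable becomes inner and can be shifted too.
    rw [circleCoeff_swap hc]
    simp only [e2, circleCoeff_const_mul]
  have hn : ‖circleCoeff (fun y : ℝ => circleCoeff (fun x : ℝ => h (x + t * I) (y + s * I)) (k 0))
      (k 1)‖ ≤ B :=
    norm_circleCoeff_le (fun y => norm_circleCoeff_le (fun x => hB _ _ (by simpa using ht ▸ hbκ)
      (by simpa using hs ▸ hbκ)) _) _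
  rw [hfin, norm_mul, norm_mul, norm_real, norm_real, Real.norm_of_nonneg (Real.exp_pos _).le,
    Real.norm_of_nonneg (Real.exp_pos _).le, hkt, hks, ← mul_assoc, ← Real.exp_add, freqLength,
    Fin.sum_univ_two, mul_comm B]
  have : -(b * |(k 1 : ℝ)|) + -(b * |(k 0 : ℝ)|) = -(b * (|(k 0 : ℝ)| + |(k 1 : ℝ)|)) := by ring
  rw [this]
  exact mul_le_mul_of_nonneg_left hn (Real.exp_pos _).le

/-! ### Composition with a holomorphic symbol in the Wiener algebra -/

/-- The element of the Wiener algebra with the Fourier coefficients of `F`. -/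
def wienerOf (a : NNReal) (F : ℝ → ℝ → ℂ) : Wiener a := ∑' k, torusCoeff F k • Wiener.mode k

/-- The sum `∑ e^{-a|k|₁}`. -/
def decaySum (a : NNReal) : ℝ := ∑' k : Fin 2 → ℤ, Real.exp (-(a * freqLength k))

theorem decaySum_nonneg (a : NNReal) : 0 ≤ decaySum a := tsum_nonneg fun _ => (Real.exp_pos _).le

section

variable {a : NNReal} {F : ℝ → ℝ → ℂ} {B : ℝ}

/-- Decay at rate 2a against a mode of norm e^{a|k|₁} leaves a summable e^{-a|k|₁}. -/
theorem norm_torusCoeff_smul_mode_le {k : Fin 2 → ℤ}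
    (hF : ‖torusCoeff F k‖ ≤ B * Real.exp (-(2 * a * freqLength k))) :
    ‖torusCoeff F k • (Wiener.mode k : Wiener a)‖ ≤ B * Real.exp (-(a * freqLength k)) := by
  rw [norm_smul, Wiener.norm_mode, weight]
  refine (mul_le_mul_of_nonneg_right hF (Real.exp_pos _).le).trans_eq ?_
  rw [mul_assoc, ← Real.exp_add]
  congr 2
  ring

theorem summable_norm_torusCoeff_smul_mode (ha : 0 < a)
    (hF : ∀ k, ‖torusCoeff F k‖ ≤ B * Real.exp (-(2 * a * freqLength k))) :
    Summable fun k => ‖torusCoeff F k • (Wiener.mode k : Wiener a)‖ :=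
  Summable.of_nonneg_of_le (fun _ => norm_nonneg _)
    (fun k => norm_torusCoeff_smul_mode_le (hF k))
    ((summable_exp_neg_mul_freqLength (NNReal.coe_pos.mpr ha)).mul_left B)

theorem norm_wienerOf_le (ha : 0 < a)
    (hF : ∀ k, ‖torusCoeff F k‖ ≤ B * Real.exp (-(2 * a * freqLength k))) :
    ‖wienerOf a F‖ ≤ decaySum a * B := by
  have hs := summable_norm_torusCoeff_smul_mode ha hF
  refine (norm_tsum_le_tsum_norm hs).trans ?_
  rw [mul_comm, decaySum, ← tsum_mul_left]
  exact hs.tsum_le_tsum (fun k => norm_torusCoeff_smul_mode_le (hF k))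
    ((summable_exp_neg_mul_freqLength (NNReal.coe_pos.mpr ha)).mul_left B)

theorem eval_wienerOf (ha : 0 < a)
    (hF : ∀ k, ‖torusCoeff F k‖ ≤ B * Real.exp (-(2 * a * freqLength k)))
    (hc : Continuous (Function.uncurry F))
    (hper₀ : ∀ y, Function.Periodic (fun x => F x y) (2 * Real.pi))
    (hper₁ : ∀ x, Function.Periodic (F x) (2 * Real.pi)) (x : Fin 2 → ℝ) :
    Wiener.eval x (wienerOf a F) = F (x 0) (x 1) := by
  have hs := summable_norm_torusCoeff_smul_mode ha hF
  have hn : Summable fun k => ‖torusCoeff F k‖ :=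
    Summable.of_nonneg_of_le (fun _ => norm_nonneg _) hF
      ((summable_exp_neg_mul_freqLength (mul_pos two_pos (NNReal.coe_pos.mpr ha))).mul_left B)
  have h := (hs.of_norm.hasSum).mapL (Wiener.evalL x)
  simp only [map_smul, Wiener.evalL_eq_eval, Wiener.eval_mode, smul_eq_mul] at h
  exact h.unique (hasSum_torusCoeff hc hper₀ hper₁ hn x)

end

section Composition

variable {f : (Fin 2 → ℂ) → (Fin 2 → ℂ) → ℂ} {κ : ℝ}

theorem mem_complexNhd {z w : ℂ} {ζ : Fin 2 → ℂ} (hz : |z.im| < κ) (hw : |w.im| < κ)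
    (hζ : ‖ζ‖ < κ) : (![z, w], ζ) ∈ complexNhd κ := by
  refine ⟨fun i => ?_, hζ⟩
  fin_cases i
  exacts [hz, hw]

theorem ofReal_mem_complexNhd (x : Fin 2 → ℝ) {ζ : Fin 2 → ℂ} (hζ : ‖ζ‖ < κ) :
    ((fun i => (x i : ℂ)), ζ) ∈ complexNhd κ := by
  refine ⟨fun i => ?_, hζ⟩
  simpa using (norm_nonneg _).trans_lt hζ

variable (hd : DifferentiableOn ℂ (fun z : (Fin 2 → ℂ) × (Fin 2 → ℂ) => f z.1 z.2) (complexNhd κ))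
  (hper : ∀ x ζ, (x, ζ) ∈ complexNhd κ → ∀ k : Fin 2 → ℤ,
    f (fun i => x i + 2 * Real.pi * (k i : ℂ)) ζ = f x ζ)

include hper in
theorem periodic_fst {z w : ℂ} {ζ : Fin 2 → ℂ} (hz : |z.im| < κ) (hw : |w.im| < κ)
    (hζ : ‖ζ‖ < κ) : f ![z + 2 * Real.pi, w] ζ = f ![z, w] ζ := by
  rw [← hper _ ζ (mem_complexNhd hz hw hζ) ![1, 0]]
  congr 1
  funext i
  fin_cases i <;> simp

include hper in
theorem periodic_snd {z w : ℂ} {ζ : Fin 2 → ℂ} (hz : |z.im| < κ) (hw : |w.im| < κ)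
    (hζ : ‖ζ‖ < κ) : f ![z, w + 2 * Real.pi] ζ = f ![z, w] ζ := by
  rw [← hper _ ζ (mem_complexNhd hz hw hζ) ![0, 1]]
  congr 1
  funext i
  fin_cases i <;> simp

include hd hper in
theorem norm_torusCoeff_symbol_le {b B : ℝ} {ζ : Fin 2 → ℂ} (hζ : ‖ζ‖ < κ)
    (hB : ∀ x, (x, ζ) ∈ complexNhd κ → ‖f x ζ‖ ≤ B) (hb : 0 ≤ b) (hbκ : b < κ) (k : Fin 2 → ℤ) :
    ‖torusCoeff (fun x y => f ![(x : ℂ), (y : ℂ)] ζ) k‖ ≤ B * Real.exp (-(b * freqLength k)) := by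
  refine norm_torusCoeff_le (h := fun z w => f ![z, w] ζ) (κ := κ) ?_
    (fun z w hz hw => periodic_fst hper hz hw hζ) (fun z w hz hw => periodic_snd hper hz hw hζ)
    (fun z w hz hw => hB _ (mem_complexNhd hz hw hζ)) hb hbκ k
  refine hd.comp (f := fun p : ℂ × ℂ => ((![p.1, p.2] : Fin 2 → ℂ), ζ)) ?_
    fun p hp => mem_complexNhd hp.1 hp.2 hζ
  refine (DifferentiableOn.prodMk ?_ (differentiableOn_const _))
  rw [differentiableOn_pi]
  intro i
  fin_cases i <;> simp <;> fun_prop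

-- Continuity in the fibre variable, coefficient by coefficient; with the uniform decay it makes the
-- algebra-valued Cauchy integrand continuous.
include hd in
theorem continuousOn_torusCoeff_symbol (hκ : 0 < κ) (k : Fin 2 → ℤ) :
    ContinuousOn (fun ζ => torusCoeff (fun x y => f ![(x : ℂ), (y : ℂ)] ζ) k)
      {ζ : Fin 2 → ℂ | ‖ζ‖ < κ} := by
  rw [continuousOn_iff_continuous_domRestrict]
  refine continuous_circleCoeff (F := fun (ζ : {ζ : Fin 2 → ℂ | ‖ζ‖ < κ}) x =>
    circleCoeff (fun y : ℝ => f ![(x : ℂ), (y : ℂ)] ζ) (k 1)) ?_ _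
  refine continuous_circleCoeff (F := fun (p : {ζ : Fin 2 → ℂ | ‖ζ‖ < κ} × ℝ) (y : ℝ) =>
    f ![(p.2 : ℂ), (y : ℂ)] p.1) ?_ _
  refine hd.continuousOn.comp_continuous
    (f := fun q : ({ζ : Fin 2 → ℂ | ‖ζ‖ < κ} × ℝ) × ℝ =>
      ((![(q.1.2 : ℂ), (q.2 : ℂ)] : Fin 2 → ℂ), (q.1.1 : Fin 2 → ℂ))) ?_
    fun q => mem_complexNhd (by simpa using hκ) (by simpa using hκ) q.1.1.2
  refine Continuous.prodMk (continuous_pi fun i => ?_) (by fun_prop)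
  fin_cases i <;> simp <;> fun_prop

include hd hper in
/-- Composition with a bounded holomorphic periodic symbol on the ball `‖v‖ ≤ 1/2` of the Wiener
algebra. -/
theorem exists_composition {a : NNReal} (ha : 0 < a) (haκ : 2 * (a : ℝ) < κ) {ξ : Fin 2 → ℂ}
    {e B : ℝ} (he : 0 ≤ e) (hξ : ‖ξ‖ + e < κ)
    (hB : ∀ x ζ, (x, ζ) ∈ complexNhd κ → ‖ζ‖ ≤ ‖ξ‖ + e → ‖f x ζ‖ ≤ B) :
    ∃ Φ : (Fin 2 → Wiener a) → Wiener a,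
      (∀ v, ‖v‖ ≤ 1 / 2 → ‖Φ v‖ ≤ 4 * (decaySum a * B)) ∧
      (∀ v v', ‖v‖ ≤ 1 / 2 → ‖v'‖ ≤ 1 / 2 →
        ‖Φ v - Φ v'‖ ≤ 16 * (decaySum a * B) * ‖v - v'‖) ∧
      ∀ v, ‖v‖ ≤ 1 / 2 → ∀ x : Fin 2 → ℝ, Wiener.eval x (Φ v) =
        f (fun i => (x i : ℂ)) (fun i => ξ i + e * Wiener.eval x (v i)) := by
  have hκ : 0 < κ := (add_nonneg (norm_nonneg ξ) he).trans_lt hξ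
  let Z : ℂ → ℂ → Fin 2 → ℂ := fun z w i => ξ i + e * ![z, w] i
  -- The norm on ℂ² is the sup norm, so the unit bidisc is mapped into the ball of radius ‖ξ‖ + e,
  -- where B bounds f.
  have hZnorm : ∀ z w : ℂ, ‖z‖ ≤ 1 → ‖w‖ ≤ 1 → ‖Z z w‖ ≤ ‖ξ‖ + e := fun z w hz hw => by
    refine (pi_norm_le_iff_of_nonneg (by positivity)).mpr fun i => norm_add_le_of_le
      (norm_le_pi_norm ξ i) ?_
    rw [norm_mul, norm_real, Real.norm_of_nonneg he]
    refine mul_le_of_le_one_right he ?_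
    fin_cases i
    exacts [hz, hw]
  have hZcont : Continuous (Function.uncurry Z) := by
    refine continuous_pi fun i => ?_
    fin_cases i <;> simp [Function.uncurry_def, Z] <;> fun_prop
  have hs : ∀ {z : ℂ}, z ∈ Metric.sphere (0 : ℂ) 1 → ‖z‖ ≤ 1 := fun hz =>
    (mem_sphere_zero_iff_norm.mp hz).le
  have hcoeff : ∀ ζ : Fin 2 → ℂ, ‖ζ‖ ≤ ‖ξ‖ + e → ∀ k,
      ‖torusCoeff (fun x y => f ![(x : ℂ), (y : ℂ)] ζ) k‖ ≤
        B * Real.exp (-(2 * a * freqLength k)) := fun ζ hζ k =>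
    norm_torusCoeff_symbol_le hd hper (hζ.trans_lt hξ) (fun x hx => hB x ζ hx hζ)
      (by positivity) haκ k
  -- The dependence on x is absorbed into the algebra, while the fibre variable becomes the pair of
  -- integration variables.
  let G : ℂ → ℂ → Wiener a := fun z w => wienerOf a fun x y => f ![(x : ℂ), (y : ℂ)] (Z z w)
  have hGB : ∀ z ∈ Metric.sphere (0 : ℂ) 1, ∀ w ∈ Metric.sphere (0 : ℂ) 1,
      ‖G z w‖ ≤ decaySum a * B := fun z hz w hw =>
    norm_wienerOf_le ha (hcoeff _ (hZnorm z w (hs hz) (hs hw)))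
  have hGc : ContinuousOn (Function.uncurry G) (Metric.sphere 0 1 ×ˢ Metric.sphere 0 1) := by
    refine continuousOn_tsum (f := fun k (p : ℂ × ℂ) => torusCoeff
      (fun x y => f ![(x : ℂ), (y : ℂ)] (Z p.1 p.2)) k • (Wiener.mode k : Wiener a))
      (u := fun k => B * Real.exp (-(a * freqLength k))) (fun k => ?_)
      ((summable_exp_neg_mul_freqLength (NNReal.coe_pos.mpr ha)).mul_left B) fun k p hp =>
        norm_torusCoeff_smul_mode_le (hcoeff _ (hZnorm p.1 p.2 (hs hp.1) (hs hp.2)) k)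
    refine ContinuousOn.smul (f := fun p : ℂ × ℂ => torusCoeff
      (fun x y => f ![(x : ℂ), (y : ℂ)] (Z p.1 p.2)) k) ?_ continuousOn_const
    exact (continuousOn_torusCoeff_symbol hd hκ k).comp (f := Function.uncurry Z)
      hZcont.continuousOn fun p hp => (hZnorm p.1 p.2 (hs hp.1) (hs hp.2)).trans_lt hξ
  have hGev : ∀ x : Fin 2 → ℝ, ∀ z ∈ Metric.sphere (0 : ℂ) 1, ∀ w ∈ Metric.sphere (0 : ℂ) 1,
      Wiener.eval x (G z w) = f (fun i => (x i : ℂ)) (Z z w) := fun x z hz w hw => by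
    have hζ := hZnorm z w (hs hz) (hs hw)
    have hx : (fun i => (x i : ℂ)) = ![(x 0 : ℂ), (x 1 : ℂ)] := by
      funext i
      fin_cases i <;> rfl
    rw [hx]
    have h0 : ∀ t : ℝ, |(t : ℂ).im| < κ := fun t => by simpa using hκ
    refine eval_wienerOf ha (hcoeff _ hζ) ?_ (fun y t => ?_) (fun y t => ?_) x
    · refine hd.continuousOn.comp_continuous
        (f := fun q : ℝ × ℝ => ((![(q.1 : ℂ), (q.2 : ℂ)] : Fin 2 → ℂ), Z z w)) ?_
        fun q => mem_complexNhd (h0 _) (h0 _) (hζ.trans_lt hξ)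
      refine Continuous.prodMk (continuous_pi fun i => ?_) continuous_const
      fin_cases i <;> simp <;> fun_prop
    · simpa using periodic_fst hper (h0 t) (h0 y) (hζ.trans_lt hξ)
    · simpa using periodic_snd hper (h0 y) (h0 t) (hζ.trans_lt hξ)
  have hdiff : ∀ (x : Fin 2 → ℝ) (g : ℂ → Fin 2 → ℂ), Differentiable ℂ g →
      (∀ z : ℂ, ‖z‖ ≤ 1 → ‖g z‖ ≤ ‖ξ‖ + e) →
      DiffContOnCl ℂ (fun z => f (fun i => (x i : ℂ)) (g z)) (Metric.ball 0 1) :=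
    fun x g hg hgn => by
    refine DifferentiableOn.diffContOnCl ?_
    rw [closure_ball _ one_ne_zero]
    exact hd.comp (f := fun z => ((fun i => (x i : ℂ)), g z))
      ((differentiable_const _).prodMk hg).differentiableOn fun z hz =>
        ofReal_mem_complexNhd x ((hgn z (by simpa using hz)).trans_lt hξ)
  refine ⟨cauchyCalc₂ G, fun v hv => norm_cauchyCalc₂_le hGB hv,
    fun v v' hv hv' => norm_cauchyCalc₂_sub_le hGc hGB hv hv', fun v hv x => ?_⟩
  rw [map_cauchyCalc₂ (Wiener.eval x) hGc hv (g := fun z w => f (fun i => (x i : ℂ)) (Z z w))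
    (fun z hz => hdiff x _ ?_ fun w hw => hZnorm z w (hs hz) hw)
    (fun w hw => hdiff x _ ?_ fun z hz => hZnorm z w hz (mem_ball_zero_iff.mp hw).le) (hGev x)]
  · congr 1
    funext i
    fin_cases i <;> rfl
  · rw [differentiable_pi]
    intro i
    fin_cases i <;> simp [Z] <;> fun_prop
  · rw [differentiable_pi]
    intro i
    fin_cases i <;> simp [Z] <;> fun_prop

end Composition

/-- One term of the exponential series at b(1 + t). It serves both smoothness and the Sobolev
bounds. -/
theorem exists_one_add_pow_le_mul_exp {b : ℝ} (hb : 0 < b) (n : ℕ) :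
    ∃ C : ℝ, 0 ≤ C ∧ ∀ t : ℝ, 0 ≤ t → (1 + t) ^ n ≤ C * Real.exp (b * t) := by
  refine ⟨n.factorial * Real.exp b / b ^ n, by positivity, fun t ht => ?_⟩
  have h := Real.pow_div_factorial_le_exp (b * (1 + t)) (by positivity) n
  rw [div_le_iff₀ (by positivity), mul_pow, mul_add, Real.exp_add, mul_one] at h
  rw [div_mul_eq_mul_div, le_div_iff₀ (by positivity)]
  linarith

/-! ### Smoothness of elements of the Wiener algebra -/

theorem iteratedDeriv_cexp_I_mul (n : ℕ) :
    iteratedDeriv n (fun t : ℝ => Complex.exp (I * t)) =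
      fun t : ℝ => I ^ n * Complex.exp (I * t) := by
  induction n with
  | zero => simp
  | succ n ih =>
    rw [iteratedDeriv_succ, ih]
    funext t
    have h : HasDerivAt (fun t : ℝ => Complex.exp (I * t)) (Complex.exp (I * t) * (I * 1)) t :=
      ((hasDerivAt_id t).ofReal_comp.const_mul I).cexp
    rw [(h.const_mul (I ^ n)).deriv]
    ring

/-- The linear form `x ↦ k·x`. -/
def freqForm (k : Fin 2 → ℤ) : (Fin 2 → ℝ) →L[ℝ] ℝ :=
  ∑ i, (k i : ℝ) • ContinuousLinearMap.proj i

theorem freqForm_apply (k : Fin 2 → ℤ) (x : Fin 2 → ℝ) : freqForm k x = ∑ i, (k i : ℝ) * x i := by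
  simp [freqForm]

theorem norm_freqForm_le (k : Fin 2 → ℤ) : ‖freqForm k‖ ≤ freqLength k := by
  refine ContinuousLinearMap.opNorm_le_bound _ (freqLength_nonneg k) fun x => ?_
  rw [freqForm_apply, freqLength, Finset.sum_mul]
  refine (norm_sum_le _ _).trans (Finset.sum_le_sum fun i _ => ?_)
  rw [norm_mul, Real.norm_eq_abs]
  exact mul_le_mul_of_nonneg_left (norm_le_pi_norm x i) (abs_nonneg _)

theorem torusChar_eq (k : Fin 2 → ℤ) :
    torusChar k = (fun t : ℝ => Complex.exp (I * t)) ∘ freqForm k := by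
  funext x
  rw [Function.comp_apply, freqForm_apply, torusChar]
  push_cast
  rfl

theorem contDiff_cexp_I_mul : ContDiff ℝ ∞ fun t : ℝ => Complex.exp (I * t) :=
  (contDiff_const.mul ofRealCLM.contDiff).cexp

theorem contDiff_torusChar (k : Fin 2 → ℤ) : ContDiff ℝ ∞ (torusChar k) := by
  rw [torusChar_eq]
  exact contDiff_cexp_I_mul.comp (freqForm k).contDiff

theorem norm_iteratedFDeriv_torusChar_le (k : Fin 2 → ℤ) (n : ℕ) (x : Fin 2 → ℝ) :
    ‖iteratedFDeriv ℝ n (torusChar k) x‖ ≤ freqLength k ^ n := by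
  rw [torusChar_eq, (freqForm k).iteratedFDeriv_comp_right contDiff_cexp_I_mul x
    (by exact_mod_cast le_top)]
  refine (ContinuousMultilinearMap.norm_compContinuousLinearMap_le _ _).trans ?_
  rw [norm_iteratedFDeriv_eq_norm_iteratedDeriv, iteratedDeriv_cexp_I_mul, norm_mul, norm_pow,
    norm_I, one_pow, one_mul, mul_comm I, norm_exp_ofReal_mul_I, one_mul, Finset.prod_const,
    Finset.card_univ, Fintype.card_fin]
  exact pow_le_pow_left₀ (norm_nonneg _) (norm_freqForm_le k) n

theorem hasFDerivAt_torusChar (k : Fin 2 → ℤ) (x : Fin 2 → ℝ) :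
    HasFDerivAt (torusChar k) ((freqForm k).smulRight (I * torusChar k x)) x := by
  have h : HasDerivAt (fun t : ℝ => Complex.exp (I * t))
      (Complex.exp (I * freqForm k x) * (I * 1)) (freqForm k x) :=
    ((hasDerivAt_id (freqForm k x)).ofReal_comp.const_mul I).cexp
  have h2 := h.hasFDerivAt.comp x (freqForm k).hasFDerivAt
  rw [← torusChar_eq] at h2
  refine h2.congr_fderiv (ContinuousLinearMap.ext fun v => ?_)
  have : torusChar k x = Complex.exp (I * freqForm k x) := congrFun (torusChar_eq k) x
  simp [this, mul_comm]

theorem torusChar_add_two_pi (k m : Fin 2 → ℤ) (x : Fin 2 → ℝ) :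
    torusChar k (fun i => x i + 2 * Real.pi * (m i : ℝ)) = torusChar k x := by
  have : I * ∑ i, (k i : ℂ) * ((x i + 2 * Real.pi * (m i : ℝ) : ℝ) : ℂ) =
      I * ∑ i, (k i : ℂ) * (x i : ℂ) + ((∑ i, k i * m i : ℤ) : ℂ) * (2 * Real.pi * I) := by
    push_cast
    simp only [Fin.sum_univ_two]
    ring
  rw [torusChar, this, Complex.exp_add, exp_int_mul_two_pi_mul_I, mul_one, torusChar]

namespace Wiener

variable {a : NNReal}

theorem eval_eq_tsum (f : Wiener a) :
    (fun x => eval x f) = fun x => ∑' k, coeff f k * torusChar k x :=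
  funext fun x => (hasSum_eval x f).tsum_eq.symm

theorem torusPeriodic_eval (f : Wiener a) : TorusPeriodic fun x => eval x f := fun k x => by
  simp only [← (hasSum_eval _ f).tsum_eq, torusChar_add_two_pi]

theorem summable_norm_coeff_mul_freqLength_pow (ha : 0 < a) (f : Wiener a) (n : ℕ) :
    Summable fun k => ‖coeff f k‖ * freqLength k ^ n := by
  obtain ⟨C, -, hC⟩ := exists_one_add_pow_le_mul_exp (NNReal.coe_pos.mpr ha) n
  refine Summable.of_nonneg_of_le
    (fun k => mul_nonneg (norm_nonneg _) (pow_nonneg (freqLength_nonneg k) n)) (fun k => ?_)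
    (f.summable_norm_coeff_mul_weight.mul_left C)
  rw [mul_left_comm]
  refine mul_le_mul_of_nonneg_left ?_ (norm_nonneg _)
  have h0 := freqLength_nonneg k
  exact (pow_le_pow_left₀ h0 (by linarith) n).trans (hC _ h0)

/-- Each n-th derivative of the series is dominated by ∑|c_k||k|₁ⁿ, finite because of the
exponential weight. -/
theorem contDiff_eval (ha : 0 < a) (f : Wiener a) : ContDiff ℝ ∞ fun x => eval x f := by
  rw [eval_eq_tsum]
  refine contDiff_tsum (N := ⊤) (v := fun n k => ‖coeff f k‖ * freqLength k ^ n)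
    (fun k => contDiff_const.mul (contDiff_torusChar k))
    (fun n _ => summable_norm_coeff_mul_freqLength_pow ha f n) fun n k x _ => ?_
  have h : iteratedFDeriv ℝ n (fun x => coeff f k * torusChar k x) x =
      coeff f k • iteratedFDeriv ℝ n (torusChar k) x :=
    iteratedFDeriv_const_smul_apply (a := coeff f k) (f := torusChar k)
      (((contDiff_torusChar k).of_le
      (by exact_mod_cast le_top)).contDiffAt)
  rw [h, norm_smul]
  exact mul_le_mul_of_nonneg_left (norm_iteratedFDeriv_torusChar_le k n x) (norm_nonneg _)

/-- Differentiation is unbounded on the algebra, so the derivative is supplied as an element h with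
the right coefficients. -/
theorem grad_eval (ha : 0 < a) {f h : Wiener a} {i : Fin 2}
    (hfh : ∀ k, coeff h k = I * k i * coeff f k) (x : Fin 2 → ℝ) :
    grad (fun x => eval x f) x i = eval x h := by
  have hs := summable_norm_coeff_mul_freqLength_pow ha f 1
  have hd : ∀ k x, HasFDerivAt (fun x => coeff f k * torusChar k x)
      (coeff f k • (freqForm k).smulRight (I * torusChar k x)) x := fun k x =>
    (hasFDerivAt_torusChar k x).const_mul (coeff f k)
  have hn : ∀ k x, ‖coeff f k • (freqForm k).smulRight (I * torusChar k x)‖ ≤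
      ‖coeff f k‖ * freqLength k ^ 1 := fun k x => by
    rw [norm_smul, ContinuousLinearMap.norm_smulRight_apply, norm_mul, norm_torusChar, norm_I,
      mul_one, mul_one, pow_one]
    exact mul_le_mul_of_nonneg_left (norm_freqForm_le k) (norm_nonneg _)
  have h1 := hasFDerivAt_tsum hs hd hn (hasSum_eval x f).summable x
  rw [grad, eval_eq_tsum, h1.fderiv]
  have h2 := (Summable.of_norm_bounded hs fun k => hn k x).hasSum.mapL
    (ContinuousLinearMap.apply ℝ ℂ (Pi.single i 1 : Fin 2 → ℝ))
  refine h2.unique ?_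
  convert! hasSum_eval x h using 2 with k
  rw [hfh]
  simp [freqForm_apply, Pi.single_apply]
  ring

end Wiener

/-! ### Fourier coefficients and Sobolev norms -/

theorem integral_torusChar (k : Fin 2 → ℤ) :
    ∫ x in Set.Icc (0 : Fin 2 → ℝ) (fun _ => 2 * Real.pi), torusChar k x =
      if k = 0 then (2 * Real.pi : ℂ) ^ 2 else 0 := by
  have h1 : ∀ n : ℤ, ∫ t in Set.Icc (0 : ℝ) (2 * Real.pi), Complex.exp (I * (n * t)) =
      if n = 0 then (2 * Real.pi : ℂ) else 0 := fun n => by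
    rw [integral_Icc_eq_integral_Ioc, ← intervalIntegral.integral_of_le Real.two_pi_pos.le]
    split_ifs with hn
    · simp [hn]
    · have hc : I * (n : ℂ) ≠ 0 := mul_ne_zero I_ne_zero (Int.cast_ne_zero.mpr hn)
      have := integral_exp_mul_complex (a := 0) (b := 2 * Real.pi) hc
      simp only [mul_assoc] at this
      rw [this]
      have he : I * ((n : ℂ) * ((2 * Real.pi : ℝ) : ℂ)) = (n : ℂ) * (2 * Real.pi * I) := by
        push_cast
        ring
      rw [he, exp_int_mul_two_pi_mul_I]
      simp
  have hset : Set.Icc (0 : Fin 2 → ℝ) (fun _ => 2 * Real.pi) =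
      Set.univ.pi fun _ => Set.Icc (0 : ℝ) (2 * Real.pi) := (Set.pi_univ_Icc _ _).symm
  have hprod : torusChar k = fun x : Fin 2 → ℝ => ∏ i, Complex.exp (I * (k i * x i)) := by
    funext x
    rw [torusChar, Finset.mul_sum, Complex.exp_sum]
  rw [hset, hprod, volume_pi, Measure.restrict_pi_pi,
    integral_fintype_prod_eq_prod (fun i (t : ℝ) => Complex.exp (I * (k i * t)))]
  simp only [h1, Fin.prod_univ_two]
  have hk : k = 0 ↔ k 0 = 0 ∧ k 1 = 0 := by
    simp [funext_iff, Fin.forall_fin_two]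
  by_cases h0 : k 0 = 0 <;> by_cases h1 : k 1 = 0 <;> simp [h0, h1, hk, sq]

namespace Wiener

variable {a : NNReal}

theorem fourierCoeffTorus_eval (f : Wiener a) (k : Fin 2 → ℤ) :
    fourierCoeffTorus (fun x => eval x f) k = coeff f k := by
  have hterm : ∀ (j : Fin 2 → ℤ) (x : Fin 2 → ℝ), coeff f j * torusChar j x *
      Complex.exp (-(I * ∑ i, (k i : ℂ) * (x i : ℂ))) = coeff f j * torusChar (j - k) x :=
    fun j x => by
      rw [mul_assoc, torusChar, ← Complex.exp_add, torusChar]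
      congr 2
      simp only [Fin.sum_univ_two, Pi.sub_apply]
      push_cast
      ring
  set μ := (volume : Measure (Fin 2 → ℝ)).restrict
    (Set.Icc (0 : Fin 2 → ℝ) (fun _ => 2 * Real.pi))
  have : IsFiniteMeasure μ := ⟨by
    rw [Measure.restrict_apply_univ]
    exact isCompact_Icc.measure_lt_top⟩
  have hcont : ∀ j, Continuous (torusChar j) := fun j => (contDiff_torusChar j).continuous
  have hint : ∀ j, Integrable (fun x => coeff f j * torusChar (j - k) x) μ := fun j =>
    ((hcont _).integrableOn_Icc).const_mul _
  have hnorm : Summable fun j => ∫ x, ‖coeff f j * torusChar (j - k) x‖ ∂μ := by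
    have hs : Summable fun j => ‖coeff f j‖ :=
      Summable.of_nonneg_of_le (fun _ => norm_nonneg _)
        (fun j => le_mul_of_one_le_right (norm_nonneg _) (one_le_weight a j))
        f.summable_norm_coeff_mul_weight
    refine (hs.mul_left (μ.real Set.univ)).congr fun j => ?_
    simp only [norm_mul, norm_torusChar, mul_one, integral_const, smul_eq_mul]
  have hsum := hasSum_integral_of_summable_integral_norm hint hnorm
  have hev : ∀ x, eval x f * Complex.exp (-(I * ∑ i, (k i : ℂ) * (x i : ℂ))) =
      ∑' j, coeff f j * torusChar (j - k) x := fun x => by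
    rw [← (hasSum_eval x f).tsum_eq, ← tsum_mul_right]
    simp only [hterm]
  rw [fourierCoeffTorus]
  simp only [hev]
  rw [← hsum.tsum_eq, tsum_eq_single k]
  · rw [integral_const_mul, integral_torusChar, if_pos (sub_self k)]
    have hpi : (Real.pi : ℂ) ≠ 0 := ofReal_ne_zero.mpr Real.pi_ne_zero
    field_simp
  · intro j hj
    rw [integral_const_mul, integral_torusChar, if_neg (sub_ne_zero.mpr hj), mul_zero]

/-- The contraction ℓ¹ ⊂ ℓ²: each weighted coefficient is at most ‖f‖, and one factor of the square
is estimated this way. -/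
theorem tsum_enorm_coeff_sq_le (f : Wiener a) :
    ∑' k, ENNReal.ofReal (weight a k ^ 2) * ‖coeff f k‖ₑ ^ 2 ≤ ENNReal.ofReal (‖f‖ ^ 2) := by
  have hs := f.summable_norm_coeff_mul_weight
  have hle : ∀ k, ‖coeff f k‖ * weight a k ≤ ‖f‖ := fun k => by
    rw [norm_eq_tsum]
    exact hs.le_tsum k fun j _ => mul_nonneg (norm_nonneg _) (weight_pos a j).le
  have hterm : ∀ k, ENNReal.ofReal (weight a k ^ 2) * ‖coeff f k‖ₑ ^ 2 ≤
      ENNReal.ofReal (‖f‖ * (‖coeff f k‖ * weight a k)) := fun k => by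
    rw [← ofReal_norm, ← ENNReal.ofReal_pow (norm_nonneg _),
      ← ENNReal.ofReal_mul (by positivity)]
    refine ENNReal.ofReal_le_ofReal ?_
    have h0 : 0 ≤ ‖coeff f k‖ * weight a k := mul_nonneg (norm_nonneg _) (weight_pos a k).le
    nlinarith [mul_le_mul_of_nonneg_right (hle k) h0]
  refine (ENNReal.tsum_le_tsum hterm).trans_eq ?_
  rw [← ENNReal.ofReal_tsum_of_nonneg
    (fun k => mul_nonneg (norm_nonneg _) (mul_nonneg (norm_nonneg _) (weight_pos a k).le))
    (hs.mul_left _), tsum_mul_left, ← norm_eq_tsum, sq]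

theorem exists_sobolevNorm_le (ha : 0 < a) (s : ℝ) :
    ∃ D : ℝ, 0 ≤ D ∧ ∀ v : Fin 2 → Wiener a,
      sobolevNorm s (fun x j => eval x (v j)) ≤ ENNReal.ofReal (D * ‖v‖) := by
  obtain ⟨n, hn⟩ := exists_nat_ge s
  obtain ⟨C, hC0, hC⟩ := exists_one_add_pow_le_mul_exp
    (b := 2 * a) (mul_pos two_pos (NNReal.coe_pos.mpr ha)) (2 * n)
  have hw : ∀ k : Fin 2 → ℤ, (1 + ∑ i, (k i : ℝ) ^ 2) ^ s ≤ C * weight a k ^ 2 := fun k => by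
    have h1 : 1 ≤ 1 + ∑ i, (k i : ℝ) ^ 2 := by
      have := Finset.sum_nonneg fun (i : Fin 2) (_ : i ∈ Finset.univ) => sq_nonneg (k i : ℝ)
      linarith
    have h2 : 1 + ∑ i, (k i : ℝ) ^ 2 ≤ (1 + freqLength k) ^ 2 := by
      rw [freqLength, Fin.sum_univ_two, Fin.sum_univ_two, ← sq_abs (k 0 : ℝ), ← sq_abs (k 1 : ℝ)]
      nlinarith [abs_nonneg (k 0 : ℝ), abs_nonneg (k 1 : ℝ),
        mul_nonneg (abs_nonneg (k 0 : ℝ)) (abs_nonneg (k 1 : ℝ))]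
    calc (1 + ∑ i, (k i : ℝ) ^ 2) ^ s ≤ (1 + ∑ i, (k i : ℝ) ^ 2) ^ (n : ℝ) :=
          Real.rpow_le_rpow_of_exponent_le h1 hn
      _ = (1 + ∑ i, (k i : ℝ) ^ 2) ^ n := Real.rpow_natCast _ _
      _ ≤ ((1 + freqLength k) ^ 2) ^ n := pow_le_pow_left₀ (by linarith) h2 n
      _ = (1 + freqLength k) ^ (2 * n) := (pow_mul _ _ _).symm
      _ ≤ C * Real.exp (2 * a * freqLength k) := hC _ (freqLength_nonneg k)
      _ = C * weight a k ^ 2 := by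
        rw [weight, ← Real.exp_nat_mul]
        congr 2
        push_cast
        ring
  -- C compares the Sobolev weight with the squared exponential weight; the factor 2 counts the
  -- components of v.
  refine ⟨√(2 * C), Real.sqrt_nonneg _, fun v => ?_⟩
  have hsum : ∑' k : Fin 2 → ℤ, ENNReal.ofReal ((1 + ∑ i, (k i : ℝ) ^ 2) ^ s) *
      ∑ j, ‖fourierCoeffTorus (fun x => eval x (v j)) k‖ₑ ^ 2 ≤
      ENNReal.ofReal ((√(2 * C) * ‖v‖) ^ 2) := by
    simp only [fourierCoeffTorus_eval]
    calc _ ≤ ∑' k : Fin 2 → ℤ, ∑ j, ENNReal.ofReal C *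
          (ENNReal.ofReal (weight a k ^ 2) * ‖coeff (v j) k‖ₑ ^ 2) := by
          refine ENNReal.tsum_le_tsum fun k => ?_
          rw [Finset.mul_sum]
          refine Finset.sum_le_sum fun j _ => ?_
          rw [← mul_assoc, ← ENNReal.ofReal_mul hC0]
          gcongr
          exact hw k
      _ = ∑ j, ENNReal.ofReal C *
          ∑' k : Fin 2 → ℤ, ENNReal.ofReal (weight a k ^ 2) * ‖coeff (v j) k‖ₑ ^ 2 := by
          rw [Summable.tsum_finsetSum fun _ _ => ENNReal.summable]
          simp only [ENNReal.tsum_mul_left]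
      _ ≤ ∑ _j : Fin 2, ENNReal.ofReal C * ENNReal.ofReal (‖v‖ ^ 2) := by
          gcongr with j
          refine (tsum_enorm_coeff_sq_le (v j)).trans (ENNReal.ofReal_le_ofReal ?_)
          exact pow_le_pow_left₀ (norm_nonneg _) (norm_le_pi_norm v j) 2
      _ = ENNReal.ofReal ((√(2 * C) * ‖v‖) ^ 2) := by
          rw [Fin.sum_univ_two, ← ENNReal.ofReal_mul hC0, ← ENNReal.ofReal_add (by positivity)
            (by positivity), mul_pow, Real.sq_sqrt (by positivity)]
          congr 1
          ring
  rw [sobolevNorm]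
  refine (ENNReal.rpow_le_rpow hsum (by norm_num)).trans_eq ?_
  rw [ENNReal.ofReal_rpow_of_nonneg (by positivity) (by norm_num), ← Real.sqrt_eq_rpow,
    Real.sqrt_sq (by positivity)]

end Wiener

/-! ### The transport operator `(l₁ + iε l₂)·∂_x` on the torus -/

section Transport

/-- The symbol `l₁·k + iε l₂·k`. -/
def transportSymbol (l₁ l₂ : Fin 2 → ℂ) (ε : ℝ) (k : Fin 2 → ℤ) : ℂ :=
  ∑ i, (l₁ i + I * ε * l₂ i) * k i

variable {l₁ l₂ : Fin 2 → ℂ} {c Λ ε : ℝ}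

/-- With A = l₁·k, E = Re l₂·k and D = Im l₂·k, the symbol is (A - εD) + iεE. Cramer's rule recovers
k from A and E, and the factor 1/ε is the price of reading E off the imaginary part. -/
theorem freqLength_le_norm_transportSymbol (hc : 0 < c) (hΛ : 0 < Λ)
    (hreal : ∀ i, (l₁ i).im = 0) (h₁ : ∀ i, ‖l₁ i‖ ≤ Λ) (h₂ : ∀ i, ‖l₂ i‖ ≤ Λ)
    (hdet : c ≤ |(l₁ 0).re * (l₂ 1).re - (l₁ 1).re * (l₂ 0).re|) (hε : 0 < ε) (hε1 : ε ≤ 1)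
    (hεΛ : ε * (4 * Λ ^ 2) ≤ c) (k : Fin 2 → ℤ) :
    freqLength k ≤ 8 * Λ / c / ε * ‖transportSymbol l₁ l₂ ε k‖ := by
  set σ := transportSymbol l₁ l₂ ε k
  set A := (l₁ 0).re * k 0 + (l₁ 1).re * k 1
  set E := (l₂ 0).re * k 0 + (l₂ 1).re * k 1
  set D := (l₂ 0).im * k 0 + (l₂ 1).im * k 1
  have hre : σ.re = A - ε * D := by
    simp [σ, transportSymbol, A, D]
    ring
  have him : σ.im = ε * E := by
    simp [σ, transportSymbol, E, hreal]
    ring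
  have hn : freqLength k = |(k 0 : ℝ)| + |(k 1 : ℝ)| := by rw [freqLength, Fin.sum_univ_two]
  set n := freqLength k
  have hn0 : 0 ≤ n := freqLength_nonneg k
  have r₁ := fun i => (abs_re_le_norm (l₁ i)).trans (h₁ i)
  have r₂ := fun i => (abs_re_le_norm (l₂ i)).trans (h₂ i)
  have i₂ := fun i => (abs_im_le_norm (l₂ i)).trans (h₂ i)
  have hD : |D| ≤ Λ * n := by
    refine (abs_add_le _ _).trans ?_
    rw [abs_mul, abs_mul, hn, mul_add]
    gcongr
    exacts [i₂ 0, i₂ 1]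
  have hE : ε * |E| ≤ ‖σ‖ := by
    have : ε * |E| = |σ.im| := by rw [him, abs_mul, abs_of_pos hε]
    exact this ▸ abs_im_le_norm σ
  have hA : |A| ≤ ‖σ‖ + ε * (Λ * n) := by
    have : A = σ.re + ε * D := by rw [hre]; ring
    rw [this]
    refine (abs_add_le _ _).trans (add_le_add (abs_re_le_norm σ) ?_)
    rw [abs_mul, abs_of_pos hε]
    gcongr
  set d := (l₁ 0).re * (l₂ 1).re - (l₁ 1).re * (l₂ 0).re
  have hk0 : d * k 0 = A * (l₂ 1).re - E * (l₁ 1).re := by simp only [d, A, E]; ring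
  have hk1 : d * k 1 = E * (l₁ 0).re - A * (l₂ 0).re := by simp only [d, A, E]; ring
  have b0 : c * |(k 0 : ℝ)| ≤ |A| * Λ + |E| * Λ := by
    calc c * |(k 0 : ℝ)| ≤ |d| * |(k 0 : ℝ)| := by gcongr
      _ = |A * (l₂ 1).re - E * (l₁ 1).re| := by rw [← abs_mul, hk0]
      _ ≤ |A| * |(l₂ 1).re| + |E| * |(l₁ 1).re| := by
        rw [← abs_mul, ← abs_mul]
        exact abs_sub _ _
      _ ≤ _ := by gcongr; exacts [r₂ 1, r₁ 1]
  have b1 : c * |(k 1 : ℝ)| ≤ |A| * Λ + |E| * Λ := by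
    calc c * |(k 1 : ℝ)| ≤ |d| * |(k 1 : ℝ)| := by gcongr
      _ = |E * (l₁ 0).re - A * (l₂ 0).re| := by rw [← abs_mul, hk1]
      _ ≤ |E| * |(l₁ 0).re| + |A| * |(l₂ 0).re| := by
        rw [← abs_mul, ← abs_mul]
        exact abs_sub _ _
      _ ≤ |E| * Λ + |A| * Λ := by gcongr; exacts [r₁ 0, r₂ 0]
      _ = _ := add_comm _ _
  have hcn : c * n ≤ 2 * Λ * (|A| + |E|) := by
    rw [hn]
    linarith
  -- The contribution of εD is of relative size ε; the smallness assumption on ε makes it at most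
  -- half of the left side.
  have hmain : ε * (c * n) ≤ 4 * Λ * ‖σ‖ + ε * (c * n) / 2 := by
    have e1 : ε * (c * n) ≤ ε * (2 * Λ * (‖σ‖ + ε * (Λ * n) + |E|)) :=
      mul_le_mul_of_nonneg_left
        (hcn.trans (mul_le_mul_of_nonneg_left (by linarith) (by positivity))) hε.le
    have e2 : 2 * Λ * (ε * |E|) ≤ 2 * Λ * ‖σ‖ := by gcongr
    have e3 : 2 * Λ * (ε * ‖σ‖) ≤ 2 * Λ * ‖σ‖ := by
      gcongr
      exact mul_le_of_le_one_left (norm_nonneg _) hε1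
    have e4 : ε * n / 2 * (ε * (4 * Λ ^ 2)) ≤ ε * n / 2 * c := by gcongr
    linarith
  rw [div_div, div_mul_eq_mul_div, le_div_iff₀ (by positivity)]
  linarith

theorem one_le_freqLength {k : Fin 2 → ℤ} (hk : k ≠ 0) : 1 ≤ freqLength k := by
  obtain ⟨i, hi⟩ := Function.ne_iff.mp hk
  have h1 : (1 : ℝ) ≤ |(k i : ℝ)| := by exact_mod_cast Int.one_le_abs hi
  exact h1.trans (Finset.single_le_sum (f := fun i => |(k i : ℝ)|)
    (fun _ _ => abs_nonneg _) (Finset.mem_univ i))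

theorem abs_le_freqLength (k : Fin 2 → ℤ) (i : Fin 2) : |(k i : ℝ)| ≤ freqLength k :=
  Finset.single_le_sum (f := fun i => |(k i : ℝ)|) (fun _ _ => abs_nonneg _) (Finset.mem_univ i)

/-- The linear form with the given coefficients. -/
def linearForm (m : Fin 2 → ℂ) : (Fin 2 → ℝ) →ₗ[ℝ] ℂ :=
  ∑ i, (LinearMap.toSpanSingleton ℝ ℂ (m i)).comp (LinearMap.proj i)

theorem linearForm_single (m : Fin 2 → ℂ) (i : Fin 2) : linearForm m (Pi.single i 1) = m i := by
  fin_cases i <;> simp [linearForm, LinearMap.toSpanSingleton_apply]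

theorem exists_isDualPair (hc : 0 < c) (h₁ : ∀ i, ‖l₁ i‖ ≤ Λ) (h₂ : ∀ i, ‖l₂ i‖ ≤ Λ)
    (hdet : c ≤ ‖l₁ 0 * l₂ 1 - l₁ 1 * l₂ 0‖) :
    ∃ y : Fin 2 → ((Fin 2 → ℝ) →ₗ[ℝ] ℂ), IsDualPair ![l₁, l₂] y ∧
      ∀ j i, ‖y j (Pi.single i 1)‖ ≤ Λ / c := by
  obtain ⟨d, hdd⟩ : ∃ d, d = l₁ 0 * l₂ 1 - l₁ 1 * l₂ 0 := ⟨_, rfl⟩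
  rw [← hdd] at hdet
  have hd : d ≠ 0 := norm_pos_iff.mp (hc.trans_le hdet)
  have hΛ : 0 ≤ Λ := (norm_nonneg _).trans (h₁ 0)
  have hb : ∀ z : ℂ, ‖z‖ ≤ Λ → ‖z / d‖ ≤ Λ / c := fun z hz => by
    rw [norm_div]
    exact div_le_div₀ hΛ hz hc hdet
  refine ⟨![linearForm ![l₂ 1 / d, -l₂ 0 / d], linearForm ![-l₁ 1 / d, l₁ 0 / d]], ?_, ?_⟩
  · intro j k
    fin_cases j <;> fin_cases k <;> simp [linearForm_single] <;> field_simp <;>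
      first | ring1 | linear_combination -hdd
  · intro j i
    fin_cases j <;> fin_cases i <;> simp only [linearForm_single, Fin.zero_eta, Fin.mk_one,
      Matrix.cons_val_zero, Matrix.cons_val_one]
    exacts [hb _ (h₂ 1), hb _ (by simpa using h₂ 0), hb _ (by simpa using h₁ 1), hb _ (h₁ 0)]

/-- The gradient of `w^*`. -/
def gradWStar (ε : ℝ) (y : Fin 2 → ((Fin 2 → ℝ) →ₗ[ℝ] ℂ)) (i : Fin 2) : ℂ :=
  wStar ε y (Pi.single i 1)

theorem hasFDerivAt_wStar (ε : ℝ) (y : Fin 2 → ((Fin 2 → ℝ) →ₗ[ℝ] ℂ)) (x : Fin 2 → ℝ) :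
    HasFDerivAt (wStar ε y)
      (((1 / 2 : ℂ) • ((ε : ℂ) • y 0 + (1 / I : ℂ) • y 1)).toContinuousLinearMap) x :=
  (((1 / 2 : ℂ) • ((ε : ℂ) • y 0 + (1 / I : ℂ) • y 1)).toContinuousLinearMap).hasFDerivAt

theorem contDiff_wStar (ε : ℝ) (y : Fin 2 → ((Fin 2 → ℝ) →ₗ[ℝ] ℂ)) : ContDiff ℝ ∞ (wStar ε y) :=
  (((1 / 2 : ℂ) • ((ε : ℂ) • y 0 + (1 / I : ℂ) • y 1)).toContinuousLinearMap).contDiff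

theorem grad_add_mul_wStar {u : (Fin 2 → ℝ) → ℂ} (hu : ContDiff ℝ ∞ u) (b : ℂ) (ε : ℝ)
    (y : Fin 2 → ((Fin 2 → ℝ) →ₗ[ℝ] ℂ)) (x : Fin 2 → ℝ) (i : Fin 2) :
    grad (fun x => u x + b * wStar ε y x) x i = grad u x i + b * gradWStar ε y i := by
  have h := ((hu.differentiable (by simp)) x).hasFDerivAt.add
    ((hasFDerivAt_wStar ε y x).const_mul b)
  have h' : fderiv ℝ (fun x => u x + b * wStar ε y x) x = _ := h.fderiv
  rw [grad, h']
  rfl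

/-- By duality only two terms survive: ½(ε + iε · (1/i)) = ε. This is what lets w^* produce the mean
value. -/
theorem sum_mul_gradWStar {y : Fin 2 → ((Fin 2 → ℝ) →ₗ[ℝ] ℂ)} (hy : IsDualPair ![l₁, l₂] y) :
    ∑ i, (l₁ i + I * ε * l₂ i) * gradWStar ε y i = ε := by
  have h00 := hy 0 0
  have h01 := hy 0 1
  have h10 := hy 1 0
  have h11 := hy 1 1
  simp only [Fin.sum_univ_two, Matrix.cons_val_zero, Matrix.cons_val_one, if_pos, zero_ne_one,
    one_ne_zero, if_false] at h00 h01 h10 h11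
  simp only [Fin.sum_univ_two, gradWStar, wStar, one_div, inv_I]
  linear_combination (ε / 2 : ℂ) * h00 + (-I / 2) * h01 + (I * ε ^ 2 / 2) * h10 +
    (ε / 2 : ℂ) * h11 - (ε / 2 : ℂ) * (l₂ 0 * y 1 (Pi.single 0 1) + l₂ 1 * y 1 (Pi.single 1 1)) *
      I_sq

theorem norm_gradWStar_le {y : Fin 2 → ((Fin 2 → ℝ) →ₗ[ℝ] ℂ)} {Y : ℝ} (hε : 0 < ε) (hε1 : ε ≤ 1)
    (hy : ∀ j i, ‖y j (Pi.single i 1)‖ ≤ Y) (i : Fin 2) : ‖gradWStar ε y i‖ ≤ Y := by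
  have h0 := hy 0 i
  have h1 := hy 1 i
  rw [gradWStar, wStar, norm_mul]
  have : ‖(ε : ℂ) * y 0 (Pi.single i 1) + 1 / I * y 1 (Pi.single i 1)‖ ≤ 1 * Y + 1 * Y := by
    refine norm_add_le_of_le ?_ ?_
    · rw [norm_mul, norm_real, Real.norm_of_nonneg hε.le]
      gcongr
    · rw [norm_mul]
      gcongr
      simp
  norm_num at this ⊢
  linarith

/-- Existence of a bounded right inverse of `(l₁ + iε l₂)·∂_x` composed with the gradient, on the
space of grad-periodic functions `ρ_per + b w^*`. -/
theorem exists_transport_inverse {a : NNReal} (ha : 0 < a) (hc : 0 < c) (hΛ : 0 < Λ)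
    (hreal : ∀ i, (l₁ i).im = 0) (h₁ : ∀ i, ‖l₁ i‖ ≤ Λ) (h₂ : ∀ i, ‖l₂ i‖ ≤ Λ)
    (hdet : c ≤ |(l₁ 0).re * (l₂ 1).re - (l₁ 1).re * (l₂ 0).re|) (hε : 0 < ε) (hε1 : ε ≤ 1)
    (hεΛ : ε * (4 * Λ ^ 2) ≤ c) :
    ∃ y : Fin 2 → ((Fin 2 → ℝ) →ₗ[ℝ] ℂ), IsDualPair ![l₁, l₂] y ∧
      ∃ T : Fin 2 → Wiener a →L[ℂ] Wiener a, (∀ j f, ‖T j f‖ ≤ 8 * Λ / c / ε * ‖f‖) ∧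
        (∀ f, ∑ j, (l₁ j + I * ε * l₂ j) • T j f = f) ∧
        ∀ f, ∃ (ρper : (Fin 2 → ℝ) → ℂ) (b : ℂ), ContDiff ℝ ∞ ρper ∧ TorusPeriodic ρper ∧
          ∀ x j, grad (fun x => ρper x + b * wStar ε y x) x j = Wiener.eval x (T j f) := by
  have hdet' : c ≤ ‖l₁ 0 * l₂ 1 - l₁ 1 * l₂ 0‖ := by
    refine hdet.trans ?_
    have : (l₁ 0).re * (l₂ 1).re - (l₁ 1).re * (l₂ 0).re = (l₁ 0 * l₂ 1 - l₁ 1 * l₂ 0).re := by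
      simp [hreal]
    rw [this]
    exact abs_re_le_norm _
  obtain ⟨y, hy, hyb⟩ := exists_isDualPair hc h₁ h₂ hdet'
  refine ⟨y, hy, ?_⟩
  set Q := 8 * Λ / c / ε with hQdef
  have hQ : 0 ≤ Q := by positivity
  set σ := transportSymbol l₁ l₂ ε
  have hσ : ∀ k, freqLength k ≤ Q * ‖σ k‖ := fun k =>
    freqLength_le_norm_transportSymbol hc hΛ hreal h₁ h₂ hdet hε hε1 hεΛ k
  have hσpos : ∀ k, k ≠ 0 → 0 < ‖σ k‖ := fun k hk => by
    by_contra hcon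
    have h0 : ‖σ k‖ = 0 := le_antisymm (not_lt.mp hcon) (norm_nonneg _)
    have := hσ k
    rw [h0, mul_zero] at this
    linarith [one_le_freqLength hk]
  let h : Fin 2 → (Fin 2 → ℤ) → ℂ := fun j k => if k = 0 then 0 else k j / σ k
  -- The multiplier g solves the equation for a periodic function on nonzero modes and h is its
  -- gradient. The multiplier m adds at k = 0 the constant gradient of w^*/ε.
  let m : Fin 2 → (Fin 2 → ℤ) → ℂ := fun j k => if k = 0 then gradWStar ε y j / ε else k j / σ k
  let g : (Fin 2 → ℤ) → ℂ := fun k => if k = 0 then 0 else 1 / (I * σ k)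
  have hkσ : ∀ j k, k ≠ 0 → ‖(k j : ℂ) / σ k‖ ≤ Q := fun j k hk => by
    rw [norm_div, div_le_iff₀ (hσpos k hk), norm_intCast]
    exact (abs_le_freqLength k j).trans (hσ k)
  have hh : ∀ j k, ‖h j k‖ ≤ Q := fun j k => by
    simp only [h]
    split_ifs with hk
    · simpa using hQ
    · exact hkσ j k hk
  have hm : ∀ j k, ‖m j k‖ ≤ Q := fun j k => by
    simp only [m]
    split_ifs with hk
    · rw [norm_div, norm_real, Real.norm_of_nonneg hε.le, hQdef]
      gcongr
      refine (norm_gradWStar_le hε hε1 hyb j).trans ?_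
      gcongr
      linarith
    · exact hkσ j k hk
  have hg : ∀ k, ‖g k‖ ≤ Q := fun k => by
    simp only [g]
    split_ifs with hk
    · simpa using hQ
    · rw [norm_div, norm_mul, norm_I, one_mul, norm_one, div_le_iff₀ (hσpos k hk)]
      exact (one_le_freqLength hk).trans (hσ k)
  have hεc : (ε : ℂ) ≠ 0 := ofReal_ne_zero.mpr hε.ne'
  -- This splitting gives ρ_per from g and b = f̂(0)/ε from the zero mode.
  have hsplit : ∀ j, (Wiener.multiplier (m j) Q (hm j) : Wiener a →L[ℂ] Wiener a) =
      Wiener.multiplier (h j) Q (hh j) +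
        (Wiener.coeffL 0).smulRight ((gradWStar ε y j / ε) • (1 : Wiener a)) := fun j => by
    refine Wiener.hom_ext fun k => ?_
    rw [_root_.add_apply, Wiener.multiplier_unitMode, Wiener.multiplier_unitMode,
      ContinuousLinearMap.smulRight_apply, Wiener.coeffL_apply, Wiener.coeff_unitMode,
      Wiener.one_def, weight_zero]
    by_cases hk : k = 0 <;> simp [m, h, hk]
  refine ⟨fun j => Wiener.multiplier (m j) Q (hm j), fun j f => ?_, fun f => ?_, fun f => ?_⟩
  · exact ContinuousLinearMap.le_of_opNorm_le _ (Wiener.norm_multiplier_le _ _ _ hQ) f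
  · have : ∑ j, (l₁ j + I * ε * l₂ j) • (Wiener.multiplier (m j) Q (hm j) :
        Wiener a →L[ℂ] Wiener a) = ContinuousLinearMap.id ℂ (Wiener a) := by
      refine Wiener.hom_ext fun k => ?_
      simp only [_root_.sum_apply, _root_.smul_apply, Wiener.multiplier_unitMode, smul_smul,
        ← Finset.sum_smul, ContinuousLinearMap.id_apply]
      convert one_smul ℂ _ using 2
      by_cases hk : k = 0
      · simp only [m, hk, if_true, ← mul_div_assoc, ← Finset.sum_div, sum_mul_gradWStar hy]
        exact div_self hεc
      · simp only [m, hk, if_false, ← mul_div_assoc, ← Finset.sum_div]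
        exact div_self (norm_pos_iff.mp (hσpos k hk))
    simpa using congrArg (fun S => S f) this
  · set G := Wiener.multiplier g Q hg f
    refine ⟨fun x => Wiener.eval x G, Wiener.coeff f 0 / ε, Wiener.contDiff_eval ha G,
      Wiener.torusPeriodic_eval G, fun x j => ?_⟩
    have hgrad := Wiener.grad_eval ha (f := G) (h := Wiener.multiplier (h j) Q (hh j) f) (i := j)
      (fun k => ?_) x
    · change _ = Wiener.eval x (Wiener.multiplier (m j) Q (hm j) f)
      rw [grad_add_mul_wStar (Wiener.contDiff_eval ha G), hgrad, hsplit, _root_.add_apply, map_add,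
        ContinuousLinearMap.smulRight_apply, Wiener.coeffL_apply, map_smul, map_smul, map_one,
        smul_eq_mul, smul_eq_mul, mul_one]
      congr 1
      ring
    · rw [Wiener.coeff_multiplier, Wiener.coeff_multiplier]
      by_cases hk : k = 0
      · simp [h, g, hk]
      · have := norm_pos_iff.mp (hσpos k hk)
        simp only [h, g, hk, if_false]
        field_simp [I_ne_zero]

end Transport

/-! ### The normal form in the Wiener algebra -/

section NormalForm

open MvPolynomial

variable (p : MvPolynomial (Fin 2) ℝ) (q : MvPolynomial (Fin 3) ℂ)

/-- The derivative `∂_{ζ_i}` of the normal form. -/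
def gradNormalForm (ζ : Fin 2 → ℂ) (ε : ℝ) (i : Fin 2) : ℂ :=
  gradP p ζ i + I * ε * gradQ q ζ ε i

theorem aeval_apply_algHom {σ A : Type*} [CommRing A] [Algebra ℂ A] (χ : A →ₐ[ℂ] ℂ) (u : σ → A)
    (P : MvPolynomial σ ℂ) : χ (aeval u P) = MvPolynomial.eval (fun i => χ (u i)) P := by
  rw [← AlgHom.comp_apply, comp_aeval, ← aeval_eq_eval]

/-- The parameter ε is substituted as a third variable of q, so a single constant serves all ε ≤ 1.
The radius 2 comes from ‖ξ‖ ≤ 1 and ‖h‖ ≤ 1. -/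
theorem exists_normalForm_taylor (a : NNReal) :
    ∃ C : ℝ, 0 ≤ C ∧ ∀ (ε : ℝ) (ξ : Fin 2 → ℂ), 0 < ε → ε ≤ 1 → ‖ξ‖ ≤ 1 →
      ∃ Q : (Fin 2 → Wiener a) → Wiener a, Q 0 = 0 ∧
        (∀ h h', ‖h‖ ≤ 1 → ‖h'‖ ≤ 1 → ‖Q h - Q h'‖ ≤ C * (‖h‖ + ‖h'‖) * ‖h - h'‖) ∧
        ∀ h x, Wiener.eval x (Q h) =
          normalForm p q (fun i => ξ i + Wiener.eval x (h i)) ε - normalForm p q ξ ε -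
            ∑ i, gradNormalForm p q ξ ε i * Wiener.eval x (h i) := by
  let P := MvPolynomial.map (algebraMap ℝ ℂ) p
  obtain ⟨C, hC, hP⟩ := exists_norm_aeval_sub_sub_le (Wiener a) P 2 zero_le_two
  obtain ⟨D, hD, hQ⟩ := exists_norm_aeval_sub_sub_le (Wiener a) q 2 zero_le_two
  refine ⟨C + D, by positivity, fun ε ξ hε hε1 hξ => ?_⟩
  let ι := algebraMap ℂ (Wiener a)
  let u : (Fin 2 → Wiener a) → Fin 2 → Wiener a := fun h i => ι (ξ i) + h i
  let w : (Fin 2 → Wiener a) → Fin 3 → Wiener a := fun h =>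
    ![ι (ξ 0) + h 0, ι (ξ 1) + h 1, ι ε]
  have hιξ : ∀ i, ‖ι (ξ i)‖ ≤ 1 := fun i => by
    rw [norm_algebraMap']
    exact (norm_le_pi_norm ξ i).trans hξ
  have hu : ∀ h, ‖h‖ ≤ 1 → ‖u h‖ ≤ 2 := fun h hh => by
    refine (pi_norm_le_iff_of_nonneg zero_le_two).mpr fun i => ?_
    exact (norm_add_le_of_le (hιξ i) ((norm_le_pi_norm h i).trans hh)).trans (by norm_num)
  have hw : ∀ h, ‖h‖ ≤ 1 → ‖w h‖ ≤ 2 := fun h hh => by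
    refine (pi_norm_le_iff_of_nonneg zero_le_two).mpr fun i => ?_
    fin_cases i
    · exact hu h hh |> (norm_le_pi_norm (u h) 0).trans
    · exact hu h hh |> (norm_le_pi_norm (u h) 1).trans
    · change ‖ι ε‖ ≤ 2
      rw [norm_algebraMap', norm_real, Real.norm_of_nonneg hε.le]
      linarith
  have hud : ∀ h h', u h - u h' = h - h' := fun h h' => by
    funext i
    simp [u]
  have hwd : ∀ h h', ‖w h - w h'‖ ≤ ‖h - h'‖ := fun h h' => by
    refine (pi_norm_le_iff_of_nonneg (norm_nonneg _)).mpr fun i => ?_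
    fin_cases i
    · simpa [w] using norm_le_pi_norm (h - h') 0
    · simpa [w] using norm_le_pi_norm (h - h') 1
    · simp [w]
  let L : (Fin 2 → Wiener a) → Wiener a := fun h =>
    ∑ i, aeval (u 0) (pderiv i P) * h i +
      (I * ε) • ∑ i : Fin 2, aeval (w 0) (pderiv i.castSucc q) * h i
  let Q : (Fin 2 → Wiener a) → Wiener a := fun h =>
    aeval (u h) P + (I * ε) • aeval (w h) q - (aeval (u 0) P + (I * ε) • aeval (w 0) q) - L h
  refine ⟨Q, by simp [Q, L], fun h h' hh hh' => ?_, fun h x => ?_⟩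
  · have h0 : ‖(0 : Fin 2 → Wiener a)‖ ≤ 1 := by simp
    have e1 := (hP (u h) (u h') (u 0) (hu h hh) (hu h' hh') (hu 0 h0)).2.2.2
    have e2 := (hQ (w h) (w h') (w 0) (hw h hh) (hw h' hh') (hw 0 h0)).2.2.2
    simp only [hud, sub_zero] at e1
    set S := ∑ i, aeval (u 0) (pderiv i P) * (u h i - u h' i) with hS
    set S' := ∑ i, aeval (w 0) (pderiv i q) * (w h i - w h' i) with hS'
    -- The third summand of S' vanishes because both points have the same last coordinate ε; only
    -- the ξ-derivatives of q remain.
    have hSS : L h - L h' = S + (I * ε) • S' := by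
      simp only [L, hS, hS', Fin.sum_univ_succ, Fin.sum_univ_zero]
      simp [u, w, mul_sub]
      module
    have key : Q h - Q h' = (aeval (u h) P - aeval (u h') P - S) +
        (I * ε) • (aeval (w h) q - aeval (w h') q - S') := by
      have : Q h - Q h' = (aeval (u h) P + (I * ε) • aeval (w h) q) -
          (aeval (u h') P + (I * ε) • aeval (w h') q) - (L h - L h') := by
        simp only [Q]
        abel
      rw [this, hSS]
      module
    have hw0 : ∀ k, ‖w k - w 0‖ ≤ ‖k‖ := fun k => (hwd k 0).trans_eq (by rw [sub_zero])
    have hIε : ‖I * (ε : ℂ)‖ ≤ 1 := by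
      rw [norm_mul, norm_I, one_mul, norm_real, Real.norm_of_nonneg hε.le]
      exact hε1
    rw [key]
    calc _ ≤ C * (‖h‖ + ‖h'‖) * ‖h - h'‖ +
          ‖I * (ε : ℂ)‖ * (D * (‖w h - w 0‖ + ‖w h' - w 0‖) * ‖w h - w h'‖) := by
          refine norm_add_le_of_le ?_ ?_
          · exact e1
          · rw [norm_smul]
            gcongr
      _ ≤ C * (‖h‖ + ‖h'‖) * ‖h - h'‖ + 1 * (D * (‖h‖ + ‖h'‖) * ‖h - h'‖) := by
          gcongr
          exacts [hw0 h, hw0 h', hwd h h']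
      _ = _ := by ring
  · have hu' : ∀ k, (fun i => Wiener.eval x (u k i)) = fun i => ξ i + Wiener.eval x (k i) :=
      fun k => by
        funext i
        simp only [u, map_add]
        congr 1
        exact AlgHom.commutes _ _
    have hw' : ∀ k, (fun i => Wiener.eval x (w k i)) =
        ![ξ 0 + Wiener.eval x (k 0), ξ 1 + Wiener.eval x (k 1), (ε : ℂ)] := fun k => by
      funext i
      fin_cases i
      · exact congrFun (hu' k) 0
      · exact congrFun (hu' k) 1
      · exact AlgHom.commutes _ _
    have hPe : ∀ (R : MvPolynomial (Fin 2) ℝ) (ζ : Fin 2 → ℂ),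
        MvPolynomial.eval ζ (MvPolynomial.map (algebraMap ℝ ℂ) R) = aeval ζ R := fun R ζ => by
      rw [eval_map, aeval_def]
    have hpd : ∀ i, pderiv i P = MvPolynomial.map (algebraMap ℝ ℂ) (pderiv i p) := fun i =>
      pderiv_map
    simp only [Q, L, map_sub, map_add, map_smul, map_mul, aeval_apply_algHom, hu', hw',
      hpd, P, hPe, normalForm, gradNormalForm, gradP, gradQ, smul_eq_mul, Fin.sum_univ_two,
      Pi.zero_apply, map_zero, add_zero]
    ring

end NormalForm

/-! ### Uniform nondegeneracy near the zero section -/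

theorem det_ne_zero_of_linearIndependent {u v : Fin 2 → ℝ} (h : LinearIndependent ℝ ![u, v]) :
    u 0 * v 1 - u 1 * v 0 ≠ 0 := by
  intro hdet
  rw [LinearIndependent.pair_iff] at h
  have h1 := h (v 1) (-u 1) (by
    funext i
    fin_cases i <;> simp <;> linarith)
  have h2 := h (v 0) (-u 0) (by
    funext i
    fin_cases i <;> simp <;> linarith)
  have h3 := h 1 0 (by
    funext i
    fin_cases i
    · simpa using h2.2
    · simpa using h1.2)
  exact one_ne_zero h3.1

theorem gradP_ofReal_im (p : MvPolynomial (Fin 2) ℝ) (ξ : Fin 2 → ℝ) (i : Fin 2) :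
    (gradP p (fun i => (ξ i : ℂ)) i).im = 0 := by
  have : gradP p (fun i => (ξ i : ℂ)) i =
      ((MvPolynomial.eval ξ (MvPolynomial.pderiv i p) : ℝ) : ℂ) := by
    rw [gradP, ← MvPolynomial.coe_aeval_eq_eval]
    exact MvPolynomial.aeval_algebraMap_apply ℂ ξ _
  rw [this, ofReal_im]

theorem exists_uniform_det_bound {Z : Type*} [NormedAddCommGroup Z] {F G : Z → Fin 2 → ℂ}
    (hF : ∀ i, Continuous fun z => F z i) (hG : ∀ i, Continuous fun z => G z i)
    (h0 : (F 0 0).re * (G 0 1).re - (F 0 1).re * (G 0 0).re ≠ 0) :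
    ∃ c > (0 : ℝ), ∃ Λ > (0 : ℝ), ∃ ε₁ > (0 : ℝ), ∀ z, ‖z‖ < ε₁ →
      (∀ i, ‖F z i‖ ≤ Λ) ∧ (∀ i, ‖G z i‖ ≤ Λ) ∧
        c ≤ |(F z 0).re * (G z 1).re - (F z 1).re * (G z 0).re| := by
  have hd : Continuous fun z => |(F z 0).re * (G z 1).re - (F z 1).re * (G z 0).re| := by
    have hFr := fun i => continuous_re.comp (hF i)
    have hGr := fun i => continuous_re.comp (hG i)
    exact (((hFr 0).mul (hGr 1)).sub ((hFr 1).mul (hGr 0))).abs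
  have hd0 := abs_pos.mpr h0
  have e1 := hd.continuousAt.eventually (lt_mem_nhds (half_lt_self hd0))
  have hm : Continuous fun z => ‖F z 0‖ + ‖F z 1‖ + ‖G z 0‖ + ‖G z 1‖ :=
    (((hF 0).norm.add (hF 1).norm).add (hG 0).norm).add (hG 1).norm
  have e2 := hm.continuousAt.eventually (gt_mem_nhds (lt_add_one (‖F 0 0‖ + ‖F 0 1‖ + ‖G 0 0‖ +
    ‖G 0 1‖)))
  obtain ⟨ε₁, hε₁, hball⟩ := Metric.eventually_nhds_iff.mp (e1.and e2)
  refine ⟨_, half_pos hd0, ‖F 0 0‖ + ‖F 0 1‖ + ‖G 0 0‖ + ‖G 0 1‖ + 1, by positivity, ε₁, hε₁,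
    fun z hz => ?_⟩
  obtain ⟨h1, h2⟩ := hball (y := z) (by rwa [dist_zero_right])
  have a0 := norm_nonneg (F z 0)
  have a1 := norm_nonneg (F z 1)
  have a2 := norm_nonneg (G z 0)
  have a3 := norm_nonneg (G z 1)
  refine ⟨Fin.forall_fin_two.mpr ⟨?_, ?_⟩, Fin.forall_fin_two.mpr ⟨?_, ?_⟩, h1.le⟩ <;> linarith

/-- The gradients depend continuously on (ξ, ε) jointly, and at the origin the determinant is
nonzero by linear independence. -/
theorem exists_uniform_nondegeneracy (p : MvPolynomial (Fin 2) ℝ) (q : MvPolynomial (Fin 3) ℂ)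
    (hpq : LinearIndependent ℝ
      ![fun i : Fin 2 => (gradP p 0 i).re, fun i : Fin 2 => (gradQ q 0 0 i).re]) :
    ∃ c > (0 : ℝ), ∃ Λ > (0 : ℝ), ∃ ε₁ > (0 : ℝ), ∀ (ξ : Fin 2 → ℝ) (ε : ℝ),
      ‖ξ‖ < ε₁ → |ε| < ε₁ →
        (∀ i, ‖gradP p (fun i => (ξ i : ℂ)) i‖ ≤ Λ) ∧
        (∀ i, ‖gradQ q (fun i => (ξ i : ℂ)) ε i‖ ≤ Λ) ∧
        c ≤ |(gradP p (fun i => (ξ i : ℂ)) 0).re * (gradQ q (fun i => (ξ i : ℂ)) ε 1).re -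
          (gradP p (fun i => (ξ i : ℂ)) 1).re * (gradQ q (fun i => (ξ i : ℂ)) ε 0).re| := by
  have hF : ∀ i, Continuous fun z : (Fin 2 → ℝ) × ℝ => gradP p (fun i => (z.1 i : ℂ)) i := by
    intro i
    have : (fun z : (Fin 2 → ℝ) × ℝ => gradP p (fun i => (z.1 i : ℂ)) i) =
        fun z => MvPolynomial.eval (fun i => (z.1 i : ℂ))
          (MvPolynomial.map (algebraMap ℝ ℂ) (MvPolynomial.pderiv i p)) := by
      funext z
      rw [MvPolynomial.eval_map, ← MvPolynomial.aeval_def]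
      rfl
    rw [this]
    exact (MvPolynomial.continuous_eval _).comp (by fun_prop)
  have hG : ∀ i, Continuous fun z : (Fin 2 → ℝ) × ℝ =>
      gradQ q (fun i => (z.1 i : ℂ)) z.2 i := fun i => by
    refine (MvPolynomial.continuous_eval (MvPolynomial.pderiv i.castSucc q)).comp
      (continuous_pi fun j => ?_)
    fin_cases j <;> simp <;> fun_prop
  have h0 : (fun i => (((0 : (Fin 2 → ℝ) × ℝ).1 i : ℝ) : ℂ)) = 0 := by
    funext i
    simp
  obtain ⟨c, hc, Λ, hΛ, ε₁, hε₁, h⟩ := exists_uniform_det_bound hF hG (by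
    rw [h0, Prod.snd_zero]
    exact det_ne_zero_of_linearIndependent hpq)
  exact ⟨c, hc, Λ, hΛ, ε₁, hε₁, fun ξ ε hξ hε => h (ξ, ε) (by
    rw [Prod.norm_def]
    exact max_lt hξ hε)⟩

/-! ### The contraction argument -/

/-- Banach's theorem on the closed ball, which is preserved since ‖Ψ(v)‖ ≤ R/2 + ‖v‖/2. -/
theorem exists_fixedPoint_of_half_lipschitz {X : Type*} [NormedAddCommGroup X] [CompleteSpace X]
    {Ψ : X → X} {R : ℝ} (hR : 0 ≤ R) (h0 : ‖Ψ 0‖ ≤ R / 2)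
    (hΨ : ∀ v v', ‖v‖ ≤ R → ‖v'‖ ≤ R → ‖Ψ v - Ψ v'‖ ≤ 1 / 2 * ‖v - v'‖) :
    ∃ v, ‖v‖ ≤ R ∧ Ψ v = v := by
  have hmaps : Set.MapsTo Ψ (Metric.closedBall 0 R) (Metric.closedBall 0 R) := fun v hv => by
    rw [mem_closedBall_zero_iff] at hv ⊢
    have h1 := hΨ v 0 hv (by simpa using hR)
    rw [sub_zero] at h1
    have h2 := norm_le_norm_sub_add (Ψ v) (Ψ 0)
    linarith
  have hlip : ContractingWith (1 / 2) (hmaps.restrict Ψ _ _) := by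
    refine ⟨by rw [← NNReal.coe_lt_coe]; norm_num, LipschitzWith.of_dist_le_mul fun v v' => ?_⟩
    have := hΨ v v' (mem_closedBall_zero_iff.mp v.2) (mem_closedBall_zero_iff.mp v'.2)
    simpa [Subtype.dist_eq, dist_eq_norm] using this
  obtain ⟨v, hv, hfix, -⟩ := hlip.exists_fixedPoint'
    (Metric.isClosed_closedBall.isComplete) hmaps (x := 0) (by simpa using hR) (edist_ne_top _ _)
  exact ⟨v, mem_closedBall_zero_iff.mp hv, hfix⟩

theorem grad_phase {ρ : (Fin 2 → ℝ) → ℂ} (hρ : ContDiff ℝ ∞ ρ) (ξ : Fin 2 → ℝ) (e : ℝ)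
    (x : Fin 2 → ℝ) : grad (phase ξ e ρ) x = fun i => (ξ i : ℂ) + e * grad ρ x i := by
  let L : (Fin 2 → ℝ) →L[ℝ] ℂ := ofRealCLM ∘L ∑ i, ξ i • ContinuousLinearMap.proj i
  have hL : ∀ x, L x = ((∑ i, x i * ξ i : ℝ) : ℂ) := fun x => by
    simp [L, mul_comm]
  have h : HasFDerivAt (phase ξ e ρ) (L + (e : ℂ) • fderiv ℝ ρ x) x := by
    have h1 := L.hasFDerivAt (x := x)
    have h2 := ((hρ.differentiable (by simp)) x).hasFDerivAt.const_mul (e : ℂ)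
    have h3 := h1.add h2
    have : phase ξ e ρ = L + fun x => (e : ℂ) * ρ x := by
      funext x
      simp [phase, hL]
    rw [this]
    exact h3
  funext i
  rw [grad, h.fderiv]
  simp only [_root_.add_apply, _root_.smul_apply, smul_eq_mul, hL, grad]
  congr 2
  simp [Pi.single_apply]

/-- The fixed point equation for the gradient. -/
theorem exists_gradient_solution {a : NNReal} {T : Fin 2 → Wiener a →L[ℂ] Wiener a}
    {Q Φ : (Fin 2 → Wiener a) → Wiener a} {ε e τ C L μ : ℝ} (hε : 0 < ε) (he : 0 < e)
    (he1 : e ≤ 1) (hτ : 0 ≤ τ) (hC : 0 ≤ C) (hL : 0 ≤ L) (hμ : 0 ≤ μ)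
    (hT : ∀ j f, ‖T j f‖ ≤ τ / ε * ‖f‖) (hQ0 : Q 0 = 0)
    (hQ : ∀ h h', ‖h‖ ≤ 1 → ‖h'‖ ≤ 1 → ‖Q h - Q h'‖ ≤ C * (‖h‖ + ‖h'‖) * ‖h - h'‖)
    (hΦ : ∀ v, ‖v‖ ≤ 1 / 2 → ‖Φ v‖ ≤ L * μ)
    (hΦL : ∀ v v', ‖v‖ ≤ 1 / 2 → ‖v'‖ ≤ 1 / 2 → ‖Φ v - Φ v'‖ ≤ L * μ * ‖v - v'‖)
    (hsmall : (4 * τ ^ 2 * C * L + τ * L) * (μ / (ε * min ε e)) ≤ 1 / 4) :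
    ∃ v : Fin 2 → Wiener a, ‖v‖ ≤ 1 / 2 ∧ ‖v‖ ≤ 2 * τ * L * (μ / (ε * e)) ∧
      ∀ j, T j (-((e : ℂ)⁻¹ • (Q ((e : ℂ) • v) + Φ v))) = v j := by
  have hmin : 0 < min ε e := lt_min hε he
  set η := μ / (ε * e) with hη
  set δ := μ / (ε * min ε e) with hδ
  have hη0 : 0 ≤ η := by positivity
  have hηδ : η ≤ δ := by
    rw [hη, hδ]
    gcongr
    exact min_le_right _ _
  -- The quadratic term costs μ/ε² and the remainder costs μ/(εe); the minimum in δ covers both.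
  have hηδ' : e / ε * η ≤ δ := by
    have : e / ε * η = μ / (ε * ε) := by
      rw [hη]
      field_simp
    rw [this, hδ]
    gcongr
    exact min_le_left _ _
  -- Twice the bound for ‖Ψ(0)‖, as the fixed point lemma demands.
  set R := 2 * τ * L * η with hRdef
  have hR : 0 ≤ R := by positivity
  have hδ0 : 0 ≤ δ := by positivity
  have hR2 : R ≤ 1 / 2 := by
    have h1 : τ * L * η ≤ τ * L * δ := by gcongr
    have h2 : 0 ≤ 4 * τ ^ 2 * C * L * δ := by positivity
    rw [hRdef]
    linarith
  have hnorme : ‖((e : ℂ)⁻¹)‖ = e⁻¹ := by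
    rw [norm_inv, norm_real, Real.norm_of_nonneg he.le]
  have hnorme' : ∀ v : Fin 2 → Wiener a, ‖(e : ℂ) • v‖ = e * ‖v‖ := fun v => by
    rw [norm_smul, norm_real, Real.norm_of_nonneg he.le]
  have hev : ∀ v : Fin 2 → Wiener a, ‖v‖ ≤ 1 / 2 → ‖(e : ℂ) • v‖ ≤ 1 := fun v hv => by
    rw [hnorme']
    nlinarith [norm_nonneg v]
  let Ψ : (Fin 2 → Wiener a) → Fin 2 → Wiener a := fun v j =>
    T j (-((e : ℂ)⁻¹ • (Q ((e : ℂ) • v) + Φ v)))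
  have hΨ0 : ‖Ψ 0‖ ≤ R / 2 := by
    refine (pi_norm_le_iff_of_nonneg (by positivity)).mpr fun j => ?_
    simp only [Ψ, smul_zero, hQ0, zero_add]
    calc _ ≤ τ / ε * ‖-((e : ℂ)⁻¹ • Φ 0)‖ := hT j _
      _ ≤ τ / ε * (e⁻¹ * (L * μ)) := by
        rw [norm_neg, norm_smul, hnorme]
        gcongr
        exact hΦ 0 (by simp)
      _ = R / 2 := by
        rw [hRdef, hη]
        field_simp
  have hΨL : ∀ v v', ‖v‖ ≤ R → ‖v'‖ ≤ R → ‖Ψ v - Ψ v'‖ ≤ 1 / 2 * ‖v - v'‖ := by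
    intro v v' hv hv'
    have hv2 := hv.trans hR2
    have hv2' := hv'.trans hR2
    refine (pi_norm_le_iff_of_nonneg (by positivity)).mpr fun j => ?_
    have hdiff : Ψ v j - Ψ v' j = T j (-((e : ℂ)⁻¹ • ((Q ((e : ℂ) • v) - Q ((e : ℂ) • v')) +
        (Φ v - Φ v')))) := by
      simp only [Ψ]
      rw [← map_sub]
      congr 1
      module
    have hQ' : ‖Q ((e : ℂ) • v) - Q ((e : ℂ) • v')‖ ≤ C * (e * R + e * R) * (e * ‖v - v'‖) := by
      refine (hQ _ _ (hev v hv2) (hev v' hv2')).trans ?_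
      rw [← smul_sub, hnorme', hnorme', hnorme']
      gcongr
    calc ‖(Ψ v - Ψ v') j‖ ≤ τ / ε * ‖-((e : ℂ)⁻¹ • ((Q ((e : ℂ) • v) - Q ((e : ℂ) • v')) +
          (Φ v - Φ v')))‖ := by
          rw [Pi.sub_apply, hdiff]
          exact hT j _
      _ ≤ τ / ε * (e⁻¹ * (C * (e * R + e * R) * (e * ‖v - v'‖) + L * μ * ‖v - v'‖)) := by
          rw [norm_neg, norm_smul, hnorme]
          gcongr
          exact norm_add_le_of_le hQ' (hΦL v v' hv2 hv2')
      -- Substituting R in 2τCeR/ε produces the coefficient 4τ²CL of the smallness hypothesis.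
      _ = (4 * τ ^ 2 * C * L * (e / ε * η) + τ * L * η) * ‖v - v'‖ := by
          rw [hRdef, hη]
          field_simp
          ring
      _ ≤ (4 * τ ^ 2 * C * L * δ + τ * L * δ) * ‖v - v'‖ := by gcongr
      _ ≤ 1 / 2 * ‖v - v'‖ := by
          gcongr
          linarith
  obtain ⟨v, hv, hfix⟩ := exists_fixedPoint_of_half_lipschitz hR hΨ0 hΨL
  exact ⟨v, hv.trans hR2, hv, fun j => congrFun hfix j⟩

/-- The remainder acts on the ball `‖v‖ ≤ 1/2` of the Wiener algebra. -/
theorem exists_remainder_composition {κ K : ℝ} {M N : ℕ}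
    {r : (Fin 2 → ℂ) → (Fin 2 → ℂ) → ℝ → ℂ} (hr : IsRemainder κ K M N r) {a : NNReal}
    (ha : 0 < a) (haκ : 2 * (a : ℝ) < κ) {C₀ : ℝ} (hC₀ : 0 < C₀) {ε e : ℝ} (hε : 0 < ε)
    (hεκ : ε < κ) (he : 0 < e) (heκ : (C₀ + 1) * e < κ) {ξ : Fin 2 → ℂ} (hξ : ‖ξ‖ ≤ C₀ * e) :
    ∃ Φ : (Fin 2 → Wiener a) → Wiener a,
      (∀ v, ‖v‖ ≤ 1 / 2 →
        ‖Φ v‖ ≤ 16 * decaySum a * (|K| * (C₀ + 1) ^ N) * (ε ^ M + e ^ N)) ∧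
      (∀ v v', ‖v‖ ≤ 1 / 2 → ‖v'‖ ≤ 1 / 2 → ‖Φ v - Φ v'‖ ≤
        16 * decaySum a * (|K| * (C₀ + 1) ^ N) * (ε ^ M + e ^ N) * ‖v - v'‖) ∧
      ∀ v, ‖v‖ ≤ 1 / 2 → ∀ x : Fin 2 → ℝ, Wiener.eval x (Φ v) =
        r (fun i => (x i : ℂ)) (fun i => ξ i + e * Wiener.eval x (v i)) ε := by
  have hεm : ε ∈ Set.Ioo 0 κ := ⟨hε, hεκ⟩
  obtain ⟨Φ, h1, h2, h3⟩ := exists_composition (f := fun x ζ => r x ζ ε) (hr.holomorphic ε hεm)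
    (hr.periodic ε hεm) ha haκ (ξ := ξ) (e := e)
    (B := |K| * (C₀ + 1) ^ N * (ε ^ M + e ^ N)) he.le (by linarith) fun x ζ hx hζ => by
      -- ‖ξ‖ ≤ C₀e plus the bidisc radius e: the remainder is sampled only where ‖ζ‖ is of order e,
      -- hence its size ε^M + e^N.
      have hζ' : ‖ζ‖ ≤ (C₀ + 1) * e := by linarith
      have h1 : (1 : ℝ) ≤ (C₀ + 1) ^ N := one_le_pow₀ (by linarith)
      calc ‖r x ζ ε‖ ≤ K * (ε ^ M + ‖ζ‖ ^ N) := hr.bound ε hεm x ζ hx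
        _ ≤ |K| * (ε ^ M + ‖ζ‖ ^ N) := by
          gcongr
          exact le_abs_self K
        _ ≤ |K| * ((C₀ + 1) ^ N * ε ^ M + ((C₀ + 1) * e) ^ N) := by
          gcongr
          exact le_mul_of_one_le_left (by positivity) h1
        _ = |K| * (C₀ + 1) ^ N * (ε ^ M + e ^ N) := by
          rw [mul_pow]
          ring
  have hS := decaySum_nonneg a
  refine ⟨Φ, fun v hv => (h1 v hv).trans ?_, fun v v' hv hv' => (h2 v v' hv hv').trans_eq ?_, h3⟩
  · have : 0 ≤ decaySum a * (|K| * (C₀ + 1) ^ N * (ε ^ M + e ^ N)) := by positivity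
    linarith
  · ring

end

end HamiltonJacobi

/-! ### Choice of constants and assembly of the solution -/

theorem proposition4p1
    (M N : ℕ) (hM : 2 ≤ M) (hMN : M ≤ N)
    (p : MvPolynomial (Fin 2) ℝ) (q : MvPolynomial (Fin 3) ℂ)
    (hpq : LinearIndependent ℝ
      ![fun i : Fin 2 => (HamiltonJacobi.gradP p 0 i).re,
        fun i : Fin 2 => (HamiltonJacobi.gradQ q 0 0 i).re])
    (r : (Fin 2 → ℂ) → (Fin 2 → ℂ) → ℝ → ℂ) (κ K : ℝ) (hκ : 0 < κ)
    (hr : HamiltonJacobi.IsRemainder κ K M N r)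
    (C₀ : ℝ) (hC₀ : 0 < C₀) :
    ∃ ε₀ > (0 : ℝ), ∃ δ > (0 : ℝ), ∃ C : ℝ → ℝ,
      ∀ ε e : ℝ, 0 < ε → ε < ε₀ → 0 < e → e < ε₀ →
        (ε ^ M + e ^ N) / (ε * min ε e) ≤ δ →
        ∀ ξ : Fin 2 → ℝ, ‖ξ‖ ≤ C₀ * e →
          ∃ (y : Fin 2 → ((Fin 2 → ℝ) →ₗ[ℝ] ℂ)) (ρper : (Fin 2 → ℝ) → ℂ) (b : ℂ)
            (ρ : (Fin 2 → ℝ) → ℂ),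
            HamiltonJacobi.IsDualPair
              ![HamiltonJacobi.gradP p (fun i => (ξ i : ℂ)),
                HamiltonJacobi.gradQ q (fun i => (ξ i : ℂ)) ε] y ∧
            ContDiff ℝ ∞ ρper ∧ HamiltonJacobi.TorusPeriodic ρper ∧
            (∀ x, ρ x = ρper x + b * HamiltonJacobi.wStar ε y x) ∧
            HamiltonJacobi.GradPeriodic ρ ∧
            HamiltonJacobi.SolvesHJ κ (HamiltonJacobi.symbol p q r) ε
              (HamiltonJacobi.normalForm p q (fun i => (ξ i : ℂ)) ε)
              (HamiltonJacobi.phase ξ e ρ) ∧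
            ∀ s : ℝ, 1 < s →
              HamiltonJacobi.sobolevNorm s (HamiltonJacobi.grad ρ) ≤
                ENNReal.ofReal (C s * ((ε ^ M + e ^ N) / (ε * e))) := by
  open HamiltonJacobi in
  obtain ⟨c, hc, Λ, hΛ, ε₁, hε₁, hnd⟩ := exists_uniform_nondegeneracy p q hpq
  -- Any positive a with 2a < κ would do.
  obtain ⟨a, haeq⟩ : ∃ a : NNReal, (a : ℝ) = κ / 4 := ⟨⟨κ / 4, by positivity⟩, rfl⟩
  have ha : 0 < a := by
    rw [← NNReal.coe_pos, haeq]
    positivity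
  have haκ : 2 * (a : ℝ) < κ := by linarith
  obtain ⟨CQ, hCQ, hQ⟩ := exists_normalForm_taylor p q a
  choose D hD0 hD using Wiener.exists_sobolevNorm_le ha
  set τ := 8 * Λ / c
  set L := 16 * decaySum a * (|K| * (C₀ + 1) ^ N)
  have hτ : 0 ≤ τ := by positivity
  have hL : 0 ≤ L := by
    have := decaySum_nonneg a
    positivity
  -- The entries serve, in order, the Taylor estimate, the domain of r, the nondegeneracy and the
  -- absorption in the symbol bound.
  set m := min (min 1 κ) (min ε₁ (c / (4 * Λ ^ 2)))
  have hm : 0 < m := by positivity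
  -- Dividing by C₀ + 1 keeps (C₀ + 1)e below m, thus ξ + ev inside the domain. The + 1 in δ only
  -- prevents a zero denominator.
  refine ⟨m / (C₀ + 1), by positivity, 1 / (4 * (4 * τ ^ 2 * CQ * L + τ * L + 1)),
    by positivity, fun s => D s * (2 * τ * L), fun ε e hε hεm he hem hδ ξ hξ => ?_⟩
  have hm1 : m ≤ 1 := (min_le_left _ _).trans (min_le_left _ _)
  have hmκ : m ≤ κ := (min_le_left _ _).trans (min_le_right _ _)
  have hmε₁ : m ≤ ε₁ := (min_le_right _ _).trans (min_le_left _ _)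
  have hmΛ : m ≤ c / (4 * Λ ^ 2) := (min_le_right _ _).trans (min_le_right _ _)
  have hem' : (C₀ + 1) * e < m := by rwa [lt_div_iff₀' (by positivity)] at hem
  have hεm' : ε < m := hεm.trans_le (div_le_self hm.le (by linarith))
  have he1 : e ≤ 1 := by nlinarith
  have hC₀e : C₀ * e < m := by linarith
  have hξc : ‖fun i => (ξ i : ℂ)‖ ≤ C₀ * e := by
    refine (pi_norm_le_iff_of_nonneg (by positivity)).mpr fun i => ?_
    rw [norm_real]
    exact (norm_le_pi_norm ξ i).trans hξ
  obtain ⟨h₁, h₂, hdet⟩ := hnd ξ ε (by linarith) (by rw [abs_of_pos hε]; linarith)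
  have hεΛ : ε * (4 * Λ ^ 2) ≤ c := by
    rw [← le_div_iff₀ (by positivity)]
    linarith
  obtain ⟨y, hy, T, hT, hTid, hTgrad⟩ := exists_transport_inverse ha hc hΛ
    (gradP_ofReal_im p ξ) h₁ h₂ hdet hε (by linarith) hεΛ
  obtain ⟨Q, hQ0, hQL, hQe⟩ := hQ ε (fun i => (ξ i : ℂ)) hε (by linarith) (by linarith)
  obtain ⟨Φ, hΦ, hΦL, hΦe⟩ := exists_remainder_composition hr ha haκ hC₀ hε (by linarith) he
    (by linarith) hξc
  obtain ⟨v, hv, hvη, hfix⟩ := exists_gradient_solution (T := T) hε he he1 hτ hCQ hL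
    (μ := ε ^ M + e ^ N) (by positivity) hT hQ0 hQL hΦ hΦL (by
      have hA : 0 ≤ 4 * τ ^ 2 * CQ * L + τ * L := by positivity
      refine (mul_le_mul_of_nonneg_left hδ hA).trans ?_
      rw [mul_one_div, div_le_div_iff₀ (by positivity) (by norm_num)]
      linarith)
  obtain ⟨ρper, b, hρs, hρp, hρg⟩ := hTgrad (-((e : ℂ)⁻¹ • (Q ((e : ℂ) • v) + Φ v)))
  have hgrad : grad (fun x => ρper x + b * wStar ε y x) = fun x j => Wiener.eval x (v j) := by
    funext x j
    rw [hρg, hfix]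
  have hsmooth : ContDiff ℝ ∞ fun x => ρper x + b * wStar ε y x :=
    hρs.add (contDiff_const.mul (contDiff_wStar ε y))
  refine ⟨y, ρper, b, _, hy, hρs, hρp, fun _ => rfl, ⟨hsmooth, fun k x => ?_⟩, fun x => ?_,
    fun s _ => ?_⟩
  · rw [hgrad]
    funext j
    exact Wiener.torusPeriodic_eval (v j) k x
  · have hgx : grad (phase ξ e fun x => ρper x + b * wStar ε y x) x =
        fun i => (ξ i : ℂ) + e * Wiener.eval x (v i) := by
      rw [grad_phase hsmooth, hgrad]
    have hvx : ∀ i, ‖Wiener.eval x (v i)‖ ≤ 1 / 2 := fun i =>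
      (Wiener.norm_eval_le x (v i)).trans ((norm_le_pi_norm v i).trans hv)
    rw [hgx]
    refine ⟨ofReal_mem_complexNhd x (lt_of_le_of_lt ?_ (hem'.trans_le hmκ)), ?_⟩
    · refine (pi_norm_le_iff_of_nonneg (by positivity)).mpr fun i => ?_
      rw [add_mul, one_mul]
      refine norm_add_le_of_le ((norm_le_pi_norm (fun i => (ξ i : ℂ)) i).trans hξc) ?_
      rw [norm_mul, norm_real, Real.norm_of_nonneg he.le]
      exact mul_le_of_le_one_right he.le ((hvx i).trans (by norm_num))
    -- Evaluating the right-inverse identity at x gives the linearized equation for v(x); multiplied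
    -- by e, the linear terms and Q recombine into the difference of normal forms.
    · have h1 := congrArg (Wiener.eval x) (hTid (-((e : ℂ)⁻¹ • (Q ((e : ℂ) • v) + Φ v))))
      simp only [hfix, map_sum, map_smul, map_neg, map_add, hQe, hΦe v hv x, Pi.smul_apply,
        smul_eq_mul, gradNormalForm] at h1
      have hec : (e : ℂ) ≠ 0 := ofReal_ne_zero.mpr he.ne'
      rw [symbol]
      have h2 := congrArg (fun z => (e : ℂ) * z) h1
      simp only [mul_neg, mul_inv_cancel_left₀ hec, Fin.sum_univ_two] at h2
      linear_combination h2
  · rw [hgrad]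
    refine (hD s v).trans (ENNReal.ofReal_le_ofReal ?_)
    rw [mul_assoc (D s)]
    exact mul_le_mul_of_nonneg_left hvη (hD0 s)
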